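/- **Setting.** Let $d\ge 1$, let $K_d=\prod_{j=1}^d[a_j,b_j]\subset\mathbb R^d$ be a nonempty compact interval, let $\|\cdot\|$ be the Euclidean norm, and put $B(x_0,\gamma)=\{x:\|x-x_0\|\le\gamma\}$. On a probability space let $(W_n)_{n\ge1}$ and $(g_n)_{n\ge1}$ be two sequences, independent of each other, such that * $(g_n)_{n\ge1}$ is a sequence of independent, symmetric, complex-valued random variables with $\mathbb E\,e^{\Re(\overline z g_n)}\le e^{|z|^2/2}$ for all $z\in\mathbb C$; * each $W_n$ is an (almost surely) continuous complex-valued random field on $K_d$, and for every $x\in K_d$, almost surely $\sum_{n\ge1}|W_n(x)|^2<\infty$. For $N\ge0$ set $S_N(x)=\sum_{n=1}^N W_n(x)g_n$, let $S(x)=\lim_{N\to\infty}S_N(x)$ (this limit exists almost surely for each $x$), and let $R_N=S-S_N$ and $r_N(x,y)=\big(\sum_{n>N}|W_n(x)-W_n(y)|^2\big)^{1/2}\in[0,\infty]$. Let $\rho:\mathbb R^d\times\mathbb R^d\to[0,\infty)$ be a quasi-metric: $\rho$ is continuous and symmetric, $\rho(x,y)=0$ iff $x=y$, and for some $\kappa\ge1$,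 $\rho(x,z)\le\kappa(\rho(x,y)+\rho(y,z))$ for all $x,y,z$. Assume that for some $0<\underline H\le\overline H\le1$ and $c_1,c_2\in(0,\infty)$, $c_1\|x-y\|^{\overline H}\le\rho(x,y)\le c_2\|x-y\|^{\underline H}$ whenever $\|x-y\|\le1$. Let $\Omega'$ be an event of probability one, $\beta\in(0,1]$ and $\eta\in\mathbb R$ random variables, and $(b(N))_{N\ge0}$ a sequence of positive random variables. For $x_0\in K_d$ and a random variable $\gamma>0$, let $A(x_0,\gamma)$ be the assumption that on $\Omega'$, for all $N\ge0$ and all $x,y\in B(x_0,\gamma)\cap K_d$, $$r_N(x,y)\le b(N)\,\rho(x,y)^{\beta}\,|\log\rho(x,y)|^{\eta}$$ (the right-hand side is $0$ if $x=y$, and $+\infty$ if $\rho(x,y)=1$ and $\eta<0$). **Corollary.** 1. Assume that for every $x_0\in K_d$ there is a random variable $\gamma>0$, possibly depending on $x_0$, such that $A(x_0,\gamma)$ holds ($\Omega',\beta,\eta,(b(N)),\rho$ being the same for all $x_0$). Then almost surely $S_N(x)$ converges to $S(x)$ for all $x\in K_d$, and there is $C\in(0,\infty)$ such that for all $N\ge0$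 and all $x,y\in K_d$, $$|R_N(x)-R_N(y)|\le C\,b(N)\sqrt{\log(N+2)}\;\rho(x,y)^{\beta}\,\big[\log\big(1+\rho(x,y)^{-1}\big)\big]^{\eta+1/2},$$ where the right-hand side is $0$ if $x=y$. If moreover for some $x_0\in K_d$, almost surely $|R_N(x_0)|\le b(N)\sqrt{\log(N+2)}$ for all $N\ge0$, then $$\sup_{N\ge0}\ \sup_{x\in K_d}\frac{|R_N(x)|}{b(N)\sqrt{\log(N+2)}}<+\infty\quad\text{almost surely.}$$ 2. Let $x_0\in K_d$ and let $\gamma>0$ be deterministic such that $A(x_0,\gamma)$ holds. Then almost surely $S_N(x)$ converges to $S(x)$ for all $x\in B(x_0,\gamma)\cap K_d$, and there is $C\in(0,\infty)$ such that the first displayed inequality of part 1 holds for all $N\ge0$ and all $x,y\in B(x_0,\gamma)\cap K_d$. If moreover, almost surely, $|R_N(x_0)|\le b(N)\sqrt{\log(N+2)}$ for all $N\ge0$ (for this same $x_0$), then almost surely there is $C\in(0,\infty)$ such that $|R_N(x)|\le C\,b(N)\sqrt{\log(N+2)}$ for all $N\ge0$ and all $x\in B(x_0,\gamma)\cap K_d$.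 -/

import Mathlib

open MeasureTheory ProbabilityTheory Filter Topology
open scoped ENNReal

noncomputable section

namespace SubGaussianSeries

/-- `ℝ^d` with the Euclidean norm. -/
abbrev Euc (d : ℕ) : Type := EuclideanSpace ℝ (Fin d)

/-- The compact interval `∏ j, [lo j, hi j]` of `ℝ^d`. -/
def box {d : ℕ} (lo hi : Fin d → ℝ) : Set (Euc d) :=
  {x | ∀ j, x j ∈ Set.Icc (lo j) (hi j)}

/-- A quasi-metric on `ℝ^d`: continuous, nonnegative, faithful, symmetric, and satisfying
a quasi-triangle inequality. -/
structure IsQuasiMetric {d : ℕ} (ρ : Euc d → Euc d → ℝ) : Prop where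
  continuous : Continuous (Function.uncurry ρ)
  nonneg : ∀ x y, 0 ≤ ρ x y
  faithful : ∀ x y, ρ x y = 0 ↔ x = y
  symm : ∀ x y, ρ x y = ρ y x
  quasi_triangle : ∃ κ : ℝ, 1 ≤ κ ∧ ∀ x y z, ρ x z ≤ κ * (ρ x y + ρ y z)

/-- `ρ` is locally comparable with powers of the Euclidean distance. -/
def IsHolderControlled {d : ℕ} (ρ : Euc d → Euc d → ℝ) : Prop :=
  ∃ Hlow Hup c₁ c₂ : ℝ, 0 < Hlow ∧ Hlow ≤ Hup ∧ Hup ≤ 1 ∧ 0 < c₁ ∧ 0 < c₂ ∧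
    ∀ x y : Euc d, ‖x - y‖ ≤ 1 →
      c₁ * ‖x - y‖ ^ Hup ≤ ρ x y ∧ ρ x y ≤ c₂ * ‖x - y‖ ^ Hlow

variable {Ω : Type*} [MeasurableSpace Ω]

/-- The complex random variable `Z` is sub-Gaussian with parameter `s`:
`𝔼 exp (Re (conj z * Z)) ≤ exp (s² |z|² / 2)` for every complex `z`. The expectation of the
nonnegative variable is taken in `[0, ∞]`. -/
def IsSubGaussian (μ : Measure Ω) (Z : Ω → ℂ) (s : ℝ) : Prop :=
  ∀ z : ℂ, ∫⁻ ω, ENNReal.ofReal (Real.exp ((starRingEnd ℂ) z * Z ω).re) ∂μ ≤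
    ENNReal.ofReal (Real.exp (s ^ 2 * ‖z‖ ^ 2 / 2))

/-- The standing assumption on the sequences of weights and of sub-Gaussian variables.
The index `n : ℕ` stands for the `(n + 1)`-st term of the sequences. The two sequences are
independent of each other (random fields being seen as random elements of a product space). -/
structure IsCondSubGaussian {d : ℕ} {K : Set (Euc d)} (μ : Measure Ω)
    (W : ℕ → K → Ω → ℂ) (g : ℕ → Ω → ℂ) : Prop where
  measurable_W : ∀ n x, Measurable (W n x)
  measurable_g : ∀ n, Measurable (g n)
  indep_W_g : IndepFun (fun ω n x => W n x ω) (fun ω n => g n ω) μ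
  indep_g : iIndepFun g μ
  symmetric_g : ∀ n, IdentDistrib (g n) (fun ω => -g n ω) μ μ
  subGaussian_g : ∀ n, IsSubGaussian μ (g n) 1
  continuous_W : ∀ᵐ ω ∂μ, ∀ n, Continuous (fun x => W n x ω)
  summable_W : ∀ x, ∀ᵐ ω ∂μ, Summable (fun n => ‖W n x ω‖ ^ 2)

section Fields

variable {d : ℕ} {K : Set (Euc d)}

/-- `S_N`, the sum of the first `N` terms. -/
def partialSum (W : ℕ → K → Ω → ℂ) (g : ℕ → Ω → ℂ) (N : ℕ) (x : K) (ω : Ω) : ℂ :=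
  ∑ n ∈ Finset.range N, W n x ω * g n ω

/-- `S`, the limit of the partial sums (meaningful where the partial sums converge). -/
def limitField (W : ℕ → K → Ω → ℂ) (g : ℕ → Ω → ℂ) (x : K) (ω : Ω) : ℂ :=
  limUnder atTop (fun N => partialSum W g N x ω)

/-- The rest `R_N = S - S_N`. -/
def rest (W : ℕ → K → Ω → ℂ) (g : ℕ → Ω → ℂ) (N : ℕ) (x : K) (ω : Ω) : ℂ :=
  limitField W g x ω - partialSum W g N x ω

/-- `r_N(x, y)`, the square root of the sum of `|W_n(x) - W_n(y)|²` over all the terms after the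
first `N`, as an element of `[0, ∞]`. -/
def restParam (W : ℕ → K → Ω → ℂ) (N : ℕ) (x y : K) (ω : Ω) : ℝ≥0∞ :=
  (∑' n : ℕ, ‖W (N + n) x ω - W (N + n) y ω‖ₑ ^ 2) ^ (1 / 2 : ℝ)

/-- The rate assumption on the conditional parameters at the point `x₀`, with the almost sure
event `Ω'`, the random variables `γ > 0`, `β ∈ (0, 1]`, `η` and the positive random sequence `b`.
The bound is an inequality in `[0, ∞]`, where a negative power of `0` is `∞`: for `η < 0` it
says nothing about pairs with `ρ x y = 1`. -/
structure HasRateAt (μ : Measure Ω) (W : ℕ → K → Ω → ℂ) (ρ : Euc d → Euc d → ℝ) (x₀ : K)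
    (Ω' : Set Ω) (γ β η : Ω → ℝ) (b : ℕ → Ω → ℝ) : Prop where
  measurableSet_event : MeasurableSet Ω'
  measure_event : μ Ω' = 1
  measurable_γ : Measurable γ
  measurable_β : Measurable β
  measurable_η : Measurable η
  measurable_b : ∀ N, Measurable (b N)
  γ_pos : ∀ ω, 0 < γ ω
  β_mem : ∀ ω, β ω ∈ Set.Ioc (0 : ℝ) 1
  b_pos : ∀ N ω, 0 < b N ω
  bound : ∀ ω ∈ Ω', ∀ N, ∀ x y : K,
    x ∈ Metric.closedBall x₀ (γ ω) → y ∈ Metric.closedBall x₀ (γ ω) →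
    restParam W N x y ω ≤ ENNReal.ofReal (b N ω) *
      (ENNReal.ofReal (ρ x y) ^ β ω * ENNReal.ofReal |Real.log (ρ x y)| ^ η ω)

/-- Almost surely, on the set `T` the partial sums converge at every point (so that every rest is
defined on `T`), and the rests satisfy the modulus of continuity with rate
`b(N) √(log (N + 2))`, up to a finite random constant. -/
def HasRestModulusOn (μ : Measure Ω) (W : ℕ → K → Ω → ℂ) (g : ℕ → Ω → ℂ)
    (ρ : Euc d → Euc d → ℝ) (β η : Ω → ℝ) (b : ℕ → Ω → ℝ) (T : Set K) : Prop :=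
  ∀ᵐ ω ∂μ,
    (∀ x ∈ T, Tendsto (fun N => partialSum W g N x ω) atTop (𝓝 (limitField W g x ω))) ∧
    ∃ C : ℝ, 0 < C ∧ ∀ N : ℕ, ∀ x ∈ T, ∀ y ∈ T,
      ‖rest W g N x ω - rest W g N y ω‖ ≤
        C * b N ω * √(Real.log (N + 2)) *
          (ρ x y ^ β ω * Real.log (1 + (ρ x y)⁻¹) ^ (η ω + 1 / 2))

/-- Almost surely, for all `N`, `|R_N(x₀)| ≤ b(N) √(log (N + 2))`. -/
def HasPointwiseRate (μ : Measure Ω) (W : ℕ → K → Ω → ℂ) (g : ℕ → Ω → ℂ)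
    (b : ℕ → Ω → ℝ) (x₀ : K) : Prop :=
  ∀ᵐ ω ∂μ, ∀ N : ℕ, ‖rest W g N x₀ ω‖ ≤ b N ω * √(Real.log (N + 2))

end Fields

end SubGaussianSeries

end

/-! Freeze the weights `W`: by independence (`ae_of_indepFun`) every almost sure statement about the
pair reduces to one about a series `∑ aᵢ gᵢ` with deterministic coefficients. Symmetry makes the
exponential of a real projection of its partial sums a submartingale, so Doob's inequality and the
sub-Gaussian bound control all partial sums of a tail at once: the probability that one of them
exceeds `t` times the `ℓ²` norm of the tail is at most `4 exp (-t²/8)`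
(`measure_exists_tail_lt_le`).

This is applied to increments over pairs of points from nets of mesh `2⁻ⁿ`, whose number grows only
geometrically in `n`. With `t` of order `√(n+1) √(log (N+2))` the exceptional probabilities are
summable over pairs, levels `n` and ranks `N`, so almost surely one random constant serves
everywhere (`IsCondSubGaussian.ae_exists_hasTailControl`). The factor `√(log (N+2))` pays for
uniformity in `N`; the factor `√(n+1)`, comparable to `√(log ρ⁻¹)` at scale `2⁻ⁿ`, turns the
exponent `η` into `η + 1/2`.

The rest is pathwise. The rate assumption is inserted for each `ω`, so the dependence of `β`, `η`,
`b` on `g` plays no role. Deterministic chaining (`exists_logModulus`) extends the bound from the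
nets to all points for the continuous functions `S_M - S_N`, with a constant independent of `N` and
`M`. Taking `N = 0` gives convergence everywhere from convergence on the nets; letting `M → ∞` gives
the bound for the rests. -/

open MeasureTheory ProbabilityTheory Filter Topology
open scoped ENNReal

noncomputable section

namespace SubGaussianSeries

/-! ### Doob's maximal inequality for exponentials of random walks. -/

section Maximal

set_option linter.unusedSectionVars false

variable {Ω : Type*} [MeasurableSpace Ω] {μ : Measure Ω}

/-- The σ-algebra generated by the first `n` terms of a sequence. -/
abbrev pastSigma (X : ℕ → Ω → ℝ) (n : ℕ) : MeasurableSpace Ω :=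
  ⨆ k ∈ {k | k < n}, MeasurableSpace.comap (X k) inferInstance

theorem pastSigma_le {X : ℕ → Ω → ℝ} (hX : ∀ k, Measurable (X k)) (n : ℕ) :
    pastSigma X n ≤ ‹MeasurableSpace Ω› :=
  iSup₂_le fun k _ => (hX k).comap_le

theorem measurable_pastSigma {X : ℕ → Ω → ℝ} {k n : ℕ} (h : k < n) :
    Measurable[pastSigma X n] (X k) := by
  refine Measurable.mono (comap_measurable (X k)) ?_ le_rfl
  exact le_iSup₂_of_le k h le_rfl

theorem indep_pastSigma {X : ℕ → Ω → ℝ} (hX : ∀ k, Measurable (X k)) (hi : iIndepFun X μ) (n : ℕ) :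
    Indep (pastSigma X n) (MeasurableSpace.comap (X n) inferInstance) μ := by
  suffices Indep (⨆ k ∈ {k | k < n}, MeasurableSpace.comap (X k) inferInstance)
      (⨆ k ∈ ({n} : Set ℕ), MeasurableSpace.comap (X k) inferInstance) μ by
    rwa [iSup_singleton] at this
  exact indep_iSup_of_disjoint (fun k => (hX k).comap_le) hi (by simp)

theorem measurable_sum_pastSigma {X : ℕ → Ω → ℝ} {j n : ℕ} (h : j ≤ n) :
    Measurable[pastSigma X n] (fun ω => ∑ i ∈ Finset.range j, X i ω) := by
  let := pastSigma X n
  refine Finset.measurable_sum _ fun i hi => ?_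
  exact measurable_pastSigma ((Finset.mem_range.1 hi).trans_le h)

theorem measurableSet_hit_pastSigma {X : ℕ → Ω → ℝ} (n : ℕ) (t : ℝ) :
    MeasurableSet[pastSigma X n] {ω | ∃ j ≤ n, t ≤ ∑ i ∈ Finset.range j, X i ω} := by
  have : {ω | ∃ j ≤ n, t ≤ ∑ i ∈ Finset.range j, X i ω} =
      ⋃ j ∈ {j | j ≤ n}, {ω | t ≤ ∑ i ∈ Finset.range j, X i ω} := by ext; simp
  rw [this]
  let := pastSigma X n
  refine MeasurableSet.biUnion (Set.to_countable _) fun j hj => ?_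
  exact measurableSet_le measurable_const (measurable_sum_pastSigma hj)

theorem lintegral_mul_exp_next {X : ℕ → Ω → ℝ} (hX : ∀ k, Measurable (X k)) (hi : iIndepFun X μ)
    (n : ℕ) {f : Ω → ℝ≥0∞} (hf : Measurable[pastSigma X n] f) :
    ∫⁻ ω, f ω * ENNReal.ofReal (Real.exp (X n ω)) ∂μ =
      (∫⁻ ω, f ω ∂μ) * ∫⁻ ω, ENNReal.ofReal (Real.exp (X n ω)) ∂μ := by
  refine lintegral_mul_eq_lintegral_mul_lintegral_of_independent_measurableSpace
    (pastSigma_le hX n) (hX n).comap_le (indep_pastSigma hX hi n) hf ?_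
  exact (ENNReal.measurable_ofReal.comp Real.measurable_exp).comp (comap_measurable (X n))

theorem ofReal_exp_sum_succ (X : ℕ → Ω → ℝ) (n : ℕ) (ω : Ω) :
    ENNReal.ofReal (Real.exp (∑ i ∈ Finset.range (n + 1), X i ω)) =
      ENNReal.ofReal (Real.exp (∑ i ∈ Finset.range n, X i ω)) *
        ENNReal.ofReal (Real.exp (X n ω)) := by
  rw [Finset.sum_range_succ, Real.exp_add, ENNReal.ofReal_mul (Real.exp_nonneg _)]

theorem measurable_exp_sum_pastSigma (X : ℕ → Ω → ℝ) (n : ℕ) :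
    Measurable[pastSigma X n]
      (fun ω => ENNReal.ofReal (Real.exp (∑ i ∈ Finset.range n, X i ω))) :=
  let := pastSigma X n
  (ENNReal.measurable_ofReal.comp Real.measurable_exp).comp (measurable_sum_pastSigma le_rfl)

theorem lintegral_exp_sum_le [IsProbabilityMeasure μ] {X : ℕ → Ω → ℝ}
    (hX : ∀ k, Measurable (X k)) (hi : iIndepFun X μ) {s : ℕ → ℝ}
    (hs : ∀ k, ∫⁻ ω, ENNReal.ofReal (Real.exp (X k ω)) ∂μ ≤ ENNReal.ofReal (Real.exp (s k)))
    (n : ℕ) :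
    ∫⁻ ω, ENNReal.ofReal (Real.exp (∑ i ∈ Finset.range n, X i ω)) ∂μ ≤
      ENNReal.ofReal (Real.exp (∑ i ∈ Finset.range n, s i)) := by
  induction n with
  | zero => simp
  | succ n ih =>
    simp_rw [ofReal_exp_sum_succ]
    rw [lintegral_mul_exp_next hX hi n (measurable_exp_sum_pastSigma X n), Finset.sum_range_succ,
      Real.exp_add, ENNReal.ofReal_mul (Real.exp_nonneg _)]
    exact mul_le_mul' ih (hs n)

/-- Doob's maximal inequality for the exponential of a random walk. -/
theorem exp_mul_measure_hit_le [IsProbabilityMeasure μ] {X : ℕ → Ω → ℝ}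
    (hX : ∀ k, Measurable (X k)) (hi : iIndepFun X μ)
    (h1 : ∀ k, 1 ≤ ∫⁻ ω, ENNReal.ofReal (Real.exp (X k ω)) ∂μ) (t : ℝ) (n : ℕ) :
    ENNReal.ofReal (Real.exp t) * μ {ω | ∃ j ≤ n, t ≤ ∑ i ∈ Finset.range j, X i ω} ≤
      ∫⁻ ω in {ω | ∃ j ≤ n, t ≤ ∑ i ∈ Finset.range j, X i ω},
        ENNReal.ofReal (Real.exp (∑ i ∈ Finset.range n, X i ω)) ∂μ := by
  have key : ∀ (n : ℕ) (E : Set Ω), MeasurableSet E →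
      (∀ ω ∈ E, t ≤ ∑ i ∈ Finset.range n, X i ω) →
      ENNReal.ofReal (Real.exp t) * μ E ≤
        ∫⁻ ω in E, ENNReal.ofReal (Real.exp (∑ i ∈ Finset.range n, X i ω)) ∂μ := by
    intro n E hE h
    rw [← setLIntegral_const]
    refine setLIntegral_mono' hE fun ω hω => ?_
    exact ENNReal.ofReal_le_ofReal (Real.exp_le_exp.2 (h ω hω))
  have hm : ∀ n, MeasurableSet {ω | ∃ j ≤ n, t ≤ ∑ i ∈ Finset.range j, X i ω} := fun n =>
    pastSigma_le hX n _ (measurableSet_hit_pastSigma n t)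
  induction n with
  | zero => exact key 0 _ (hm 0) (by simp)
  | succ n ih =>
    set T := {ω | ∃ j ≤ n, t ≤ ∑ i ∈ Finset.range j, X i ω} with hT
    set T' := {ω | ∃ j ≤ n + 1, t ≤ ∑ i ∈ Finset.range j, X i ω} with hT'
    have hsub : T ⊆ T' := fun ω ⟨j, hj, h⟩ => ⟨j, hj.trans (Nat.le_succ n), h⟩
    have hsplit : T' = T ∪ (T' \ T) := (Set.union_sdiff_cancel hsub).symm
    have hmd : MeasurableSet (T' \ T) := (hm (n + 1)).diff (hm n)
    rw [hsplit, measure_union Set.disjoint_sdiff_right hmd,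
      lintegral_union hmd Set.disjoint_sdiff_right, mul_add]
    refine add_le_add (ih.trans ?_) (key (n + 1) _ hmd ?_)
    -- `T` belongs to the past, so the new factor `exp (X n)` is independent of the integrand on `T`
    -- and has mean at least one. The other piece, `T' \ T`, is first passage exactly at time `n +
    -- 1`, where the sum is at least `t`.
    · rw [← lintegral_indicator (hm n), ← lintegral_indicator (hm n)]
      have e : ∀ ω, T.indicator (fun ω => ENNReal.ofReal
          (Real.exp (∑ i ∈ Finset.range (n + 1), X i ω))) ω =
          T.indicator (fun ω => ENNReal.ofReal (Real.exp (∑ i ∈ Finset.range n, X i ω))) ω *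
            ENNReal.ofReal (Real.exp (X n ω)) := by
        intro ω
        by_cases h : ω ∈ T
        · simp only [Set.indicator_of_mem h, ofReal_exp_sum_succ]
        · rw [Set.indicator_of_notMem h, Set.indicator_of_notMem h, zero_mul]
      rw [lintegral_congr e]
      rw [lintegral_mul_exp_next hX hi n]
      · exact le_mul_of_one_le_right' (h1 n)
      · exact (measurable_exp_sum_pastSigma X n).indicator (measurableSet_hit_pastSigma n t)
    · rintro ω ⟨⟨j, hj, h⟩, hn⟩
      rcases Nat.lt_or_eq_of_le hj with hlt | rfl
      · exact absurd ⟨j, Nat.lt_succ_iff.1 hlt, h⟩ hn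
      · exact h

/-- Chernoff bound in maximal form: Doob's inequality at each finite horizon has the bound `exp (v -
t)`, free of the horizon, and the hitting events increase to the event for the infinite horizon. -/
theorem measure_hit_le [IsProbabilityMeasure μ] {X : ℕ → Ω → ℝ}
    (hX : ∀ k, Measurable (X k)) (hi : iIndepFun X μ)
    (h1 : ∀ k, 1 ≤ ∫⁻ ω, ENNReal.ofReal (Real.exp (X k ω)) ∂μ) {s : ℕ → ℝ} {v : ℝ}
    (hs : ∀ k, ∫⁻ ω, ENNReal.ofReal (Real.exp (X k ω)) ∂μ ≤ ENNReal.ofReal (Real.exp (s k)))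
    (hv : ∀ n, ∑ i ∈ Finset.range n, s i ≤ v) (t : ℝ) :
    μ {ω | ∃ j, t ≤ ∑ i ∈ Finset.range j, X i ω} ≤ ENNReal.ofReal (Real.exp (v - t)) := by
  have hU : {ω | ∃ j, t ≤ ∑ i ∈ Finset.range j, X i ω} =
      ⋃ n, {ω | ∃ j ≤ n, t ≤ ∑ i ∈ Finset.range j, X i ω} := by
    ext ω
    simp only [Set.mem_ofPred_eq, Set.mem_iUnion]
    exact ⟨fun ⟨j, h⟩ => ⟨j, j, le_rfl, h⟩, fun ⟨_, j, _, h⟩ => ⟨j, h⟩⟩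
  have hmono : Monotone fun n => {ω | ∃ j ≤ n, t ≤ ∑ i ∈ Finset.range j, X i ω} :=
    fun n m hnm ω ⟨j, hj, h⟩ => ⟨j, hj.trans hnm, h⟩
  rw [hU, hmono.measure_iUnion]
  refine iSup_le fun n => ?_
  have h := (exp_mul_measure_hit_le hX hi h1 t n).trans ((setLIntegral_le_lintegral _ _).trans
    ((lintegral_exp_sum_le hX hi hs n).trans
      (ENNReal.ofReal_le_ofReal (Real.exp_le_exp.2 (hv n)))))
  rw [Real.exp_sub, ENNReal.ofReal_div_of_pos (Real.exp_pos t),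
    ENNReal.le_div_iff_mul_le (Or.inl (by simp [Real.exp_pos])) (Or.inl ENNReal.ofReal_ne_top),
    mul_comm]
  exact h

end Maximal

/-! ### Tails of sub-Gaussian series with deterministic coefficients. -/

section Series

variable {Ω : Type*} [MeasurableSpace Ω] {μ : Measure Ω}

theorem exists_direction (z : ℂ) :
    ∃ u ∈ ({1, -1, Complex.I, -Complex.I} : Finset ℂ), ‖z‖ / 2 ≤ (u * z).re := by
  have h := Complex.norm_le_abs_re_add_abs_im z
  by_cases h1 : ‖z‖ / 2 ≤ |z.re|
  · rcases abs_cases z.re with ⟨h2, _⟩ | ⟨h2, _⟩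
    · exact ⟨1, by simp, by simp; linarith⟩
    · exact ⟨-1, by simp, by simp; linarith⟩
  · rcases abs_cases z.im with ⟨h2, _⟩ | ⟨h2, _⟩
    · exact ⟨-Complex.I, by simp, by simp; linarith⟩
    · exact ⟨Complex.I, by simp, by simp; linarith⟩

theorem norm_of_mem_directions {u : ℂ} (hu : u ∈ ({1, -1, Complex.I, -Complex.I} : Finset ℂ)) :
    ‖u‖ = 1 := by
  simp only [Finset.mem_insert, Finset.mem_singleton] at hu
  rcases hu with rfl | rfl | rfl | rfl <;> simp

theorem lintegral_exp_re_mul_le {Z : Ω → ℂ} (hZ : IsSubGaussian μ Z 1) (w : ℂ) :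
    ∫⁻ ω, ENNReal.ofReal (Real.exp (w * Z ω).re) ∂μ ≤
      ENNReal.ofReal (Real.exp (‖w‖ ^ 2 / 2)) := by
  simpa using hZ ((starRingEnd ℂ) w)

/-- By symmetry the integral equals that of the inverse exponential, and `eˣ + e⁻ˣ ≥ 2`. This gives
the submartingale property without any discussion of integrability or means. -/
theorem one_le_lintegral_exp_re_mul [IsProbabilityMeasure μ] {Z : Ω → ℂ} (hm : Measurable Z)
    (hZ : IdentDistrib Z (fun ω => -Z ω) μ μ) (w : ℂ) :
    1 ≤ ∫⁻ ω, ENNReal.ofReal (Real.exp (w * Z ω).re) ∂μ := by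
  have hφ : Measurable fun z : ℂ => ENNReal.ofReal (Real.exp (w * z).re) := by fun_prop
  have h := (hZ.comp hφ).lintegral_eq
  simp only [Function.comp_def] at h
  have h2 : (2 : ℝ≥0∞) ≤ ∫⁻ ω, ENNReal.ofReal (Real.exp (w * Z ω).re) ∂μ +
      ∫⁻ ω, ENNReal.ofReal (Real.exp (w * -Z ω).re) ∂μ := by
    rw [← lintegral_add_left (by fun_prop)]
    calc (2 : ℝ≥0∞) = ∫⁻ _, 2 ∂μ := by simp
      _ ≤ _ := by
        refine lintegral_mono fun ω => ?_
        rw [← ENNReal.ofReal_add (Real.exp_nonneg _) (Real.exp_nonneg _)]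
        rw [show (2 : ℝ≥0∞) = ENNReal.ofReal 2 by simp]
        refine ENNReal.ofReal_le_ofReal ?_
        rw [mul_neg, Complex.neg_re]
        linarith [Real.add_one_le_exp (w * Z ω).re, Real.add_one_le_exp (-(w * Z ω).re)]
  rw [← h, ← two_mul] at h2
  by_contra hlt
  push Not at hlt
  have := ENNReal.mul_lt_mul_right (a := 2) (by simp) (by simp) hlt
  rw [mul_one] at this
  exact absurd h2 (not_le.2 this)

/-- The `ℓ²` norm of the terms of index at least `N`. -/
def tailNorm (a : ℕ → ℂ) (N : ℕ) : ℝ≥0∞ := (∑' n : ℕ, ‖a (N + n)‖ₑ ^ 2) ^ (1 / 2 : ℝ)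

theorem sq_tailNorm (a : ℕ → ℂ) (N : ℕ) : tailNorm a N ^ 2 = ∑' n : ℕ, ‖a (N + n)‖ₑ ^ 2 := by
  rw [tailNorm, ← ENNReal.rpow_natCast, ← ENNReal.rpow_mul]; simp

theorem enorm_le_tailNorm (a : ℕ → ℂ) {N i : ℕ} (h : N ≤ i) : ‖a i‖ₑ ≤ tailNorm a N := by
  obtain ⟨k, rfl⟩ := Nat.exists_eq_add_of_le h
  have h1 : ‖a (N + k)‖ₑ ^ 2 ≤ tailNorm a N ^ 2 := by
    rw [sq_tailNorm]; exact ENNReal.le_tsum (f := fun n => ‖a (N + n)‖ₑ ^ 2) k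
  exact (ENNReal.pow_le_pow_left_iff two_ne_zero).1 h1

theorem sum_Ico_sq_le {a : ℕ → ℂ} {N : ℕ} (h : tailNorm a N ≠ ⊤) (n : ℕ) :
    ∑ i ∈ Finset.Ico N n, ‖a i‖ ^ 2 ≤ (tailNorm a N).toReal ^ 2 := by
  rw [← ENNReal.toReal_pow, ← ENNReal.ofReal_le_iff_le_toReal (by simp [h]), sq_tailNorm,
    ENNReal.ofReal_sum_of_nonneg (fun i _ => by positivity), Finset.sum_Ico_eq_sum_range]
  refine le_trans (le_of_eq ?_) (ENNReal.sum_le_tsum (Finset.range (n - N)))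
  refine Finset.sum_congr rfl fun i _ => ?_
  rw [ENNReal.ofReal_pow (norm_nonneg _), ofReal_norm]

variable {g : ℕ → Ω → ℂ}

theorem measure_exists_re_sum_le [IsProbabilityMeasure μ] (hm : ∀ n, Measurable (g n))
    (hi : iIndepFun g μ) (hs : ∀ n, IdentDistrib (g n) (fun ω => -g n ω) μ μ)
    (hg : ∀ n, IsSubGaussian μ (g n) 1) (w : ℕ → ℂ) {v : ℝ}
    (hv : ∀ n, ∑ i ∈ Finset.range n, ‖w i‖ ^ 2 ≤ v) (t : ℝ) :
    μ {ω | ∃ j, t ≤ (∑ i ∈ Finset.range j, w i * g i ω).re} ≤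
      ENNReal.ofReal (Real.exp (v / 2 - t)) := by
  have h := measure_hit_le (μ := μ) (X := fun i ω => (w i * g i ω).re) (s := fun i => ‖w i‖ ^ 2 / 2)
    (v := v / 2) (fun k => by have := hm k; fun_prop)
    (hi.comp (fun i z => (w i * z).re) (fun i => by fun_prop))
    (fun k => one_le_lintegral_exp_re_mul (hm k) (hs k) (w k))
    (fun k => lintegral_exp_re_mul_le (hg k) (w k))
    (fun n => by rw [← Finset.sum_div]; linarith [hv n]) t
  simpa only [Complex.re_sum] using h

/-- Maximal inequality for the tails of a sub-Gaussian series. -/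
theorem measure_exists_tail_lt_le [IsProbabilityMeasure μ] (hm : ∀ n, Measurable (g n))
    (hi : iIndepFun g μ) (hs : ∀ n, IdentDistrib (g n) (fun ω => -g n ω) μ μ)
    (hg : ∀ n, IsSubGaussian μ (g n) 1) (a : ℕ → ℂ) (N : ℕ) {t : ℝ} (ht : 0 < t) :
    μ {ω | ∃ M, ENNReal.ofReal t * tailNorm a N < ‖∑ i ∈ Finset.Ico N M, a i * g i ω‖ₑ} ≤
      4 * ENNReal.ofReal (Real.exp (-(t ^ 2 / 8))) := by
  -- An infinite tail norm makes the threshold infinite; a zero one kills every term. Only the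
  -- remaining case is probabilistic.
  by_cases htop : tailNorm a N = ⊤
  · have : {ω | ∃ M, ENNReal.ofReal t * tailNorm a N <
        ‖∑ i ∈ Finset.Ico N M, a i * g i ω‖ₑ} = ∅ := by
      ext ω; simp [htop, ENNReal.mul_top, ht]
    rw [this]; simp
  by_cases h0 : tailNorm a N = 0
  · have : {ω | ∃ M, ENNReal.ofReal t * tailNorm a N <
        ‖∑ i ∈ Finset.Ico N M, a i * g i ω‖ₑ} = ∅ := by
      ext ω
      simp only [Set.mem_ofPred_eq, Set.mem_empty_iff_false, iff_false, not_exists]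
      intro M
      rw [Finset.sum_eq_zero]
      · simp
      · intro i hi
        have := enorm_le_tailNorm a (Finset.mem_Ico.1 hi).1
        rw [h0] at this
        have : a i = 0 := by simpa using this
        simp [this]
    rw [this]; simp
  set σ := (tailNorm a N).toReal with hσ
  have hσ0 : 0 < σ := ENNReal.toReal_pos h0 htop
  set D : Finset ℂ := {1, -1, Complex.I, -Complex.I} with hD
  -- If the norm exceeds `tσ`, the real part in one of four directions exceeds `tσ/2`. The optimal
  -- Chernoff parameter for this level and variance `σ²` is `t/(2σ)`: after scaling, level and
  -- variance both equal `t²/4`, and the exponent is `t²/8 - t²/4 = -t²/8`.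
  let w : ℂ → ℕ → ℂ := fun u i => (t / 2 / σ : ℝ) * u * if N ≤ i then a i else 0
  have hsum : ∀ u j ω, ∑ i ∈ Finset.range j, w u i * g i ω =
      (t / 2 / σ : ℝ) * (u * ∑ i ∈ Finset.Ico N j, a i * g i ω) := by
    intro u j ω
    have : Finset.Ico N j = (Finset.range j).filter (N ≤ ·) := by ext; simp [and_comm]
    rw [this, Finset.sum_filter, Finset.mul_sum, Finset.mul_sum]
    refine Finset.sum_congr rfl fun i _ => ?_
    by_cases h : N ≤ i <;> simp [w, h]; ring
  have hcov : {ω | ∃ M, ENNReal.ofReal t * tailNorm a N < ‖∑ i ∈ Finset.Ico N M, a i * g i ω‖ₑ} ⊆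
      ⋃ u ∈ D, {ω | ∃ j, t ^ 2 / 4 ≤ (∑ i ∈ Finset.range j, w u i * g i ω).re} := by
    rintro ω ⟨M, hM⟩
    obtain ⟨u, hu, h⟩ := exists_direction (∑ i ∈ Finset.Ico N M, a i * g i ω)
    refine Set.mem_biUnion hu ⟨M, ?_⟩
    rw [hsum, Complex.re_ofReal_mul]
    rw [← ENNReal.ofReal_toReal htop, ← ENNReal.ofReal_mul ht.le, ← ofReal_norm,
      ENNReal.ofReal_lt_ofReal_iff_of_nonneg (by positivity)] at hM
    calc t ^ 2 / 4 = t / 2 / σ * (t * σ / 2) := by field_simp; norm_num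
      _ ≤ _ := by
        refine mul_le_mul_of_nonneg_left ?_ (by positivity)
        linarith
  refine (measure_mono hcov).trans ((measure_biUnion_finset_le _ _).trans ?_)
  refine (Finset.sum_le_card_nsmul D _ (ENNReal.ofReal (Real.exp (-(t ^ 2 / 8)))) ?_).trans ?_
  · intro u hu
    have hv : ∀ n, ∑ i ∈ Finset.range n, ‖w u i‖ ^ 2 ≤ t ^ 2 / 4 := by
      intro n
      have e : ∑ i ∈ Finset.range n, ‖w u i‖ ^ 2 =
          (t / 2 / σ) ^ 2 * ∑ i ∈ Finset.Ico N n, ‖a i‖ ^ 2 := by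
        have : Finset.Ico N n = (Finset.range n).filter (N ≤ ·) := by ext; simp [and_comm]
        rw [this, Finset.sum_filter, Finset.mul_sum]
        refine Finset.sum_congr rfl fun i _ => ?_
        by_cases h : N ≤ i
        · simp only [w, h, if_true, norm_mul, norm_of_mem_directions hu, Complex.norm_real,
            Real.norm_eq_abs, mul_one, mul_pow, sq_abs]
        · simp [w, h]
      rw [e]
      calc _ ≤ (t / 2 / σ) ^ 2 * σ ^ 2 :=
            mul_le_mul_of_nonneg_left (sum_Ico_sq_le htop n) (by positivity)
        _ = t ^ 2 / 4 := by field_simp; norm_num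
    refine (measure_exists_re_sum_le hm hi hs hg (w u) hv (t ^ 2 / 4)).trans (le_of_eq ?_)
    congr 2; ring
  · rw [nsmul_eq_mul]
    gcongr
    exact_mod_cast Finset.card_le_four

theorem tendsto_tailNorm {a : ℕ → ℂ} (ha : Summable fun n => ‖a n‖ ^ 2) :
    Tendsto (tailNorm a) atTop (𝓝 0) := by
  have h : Tendsto (fun N => ∑' n : ℕ, ‖a (n + N)‖ₑ ^ 2) atTop (𝓝 0) := by
    refine ENNReal.tendsto_sum_nat_add (fun n => ‖a n‖ₑ ^ 2) ?_
    have := ha.tsum_ofReal_ne_top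
    simpa [ENNReal.ofReal_pow, ofReal_norm] using this
  have h2 := h.ennrpow_const (1 / 2 : ℝ)
  have e : tailNorm a = fun N => (∑' n : ℕ, ‖a (N + n)‖ₑ ^ 2) ^ (1 / 2 : ℝ) := rfl
  rw [e]
  simpa [add_comm] using h2

/-- Cauchy criterion: for fixed `t`, the threshold `t * tailNorm a N` tends to `0` with `N`, so
oscillation above `1/(k+1)` after every rank has probability at most `4 exp (-t²/8)`; then `t → ∞`.
-/
theorem ae_exists_tendsto_sum [IsProbabilityMeasure μ] (hm : ∀ n, Measurable (g n))
    (hi : iIndepFun g μ) (hs : ∀ n, IdentDistrib (g n) (fun ω => -g n ω) μ μ)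
    (hg : ∀ n, IsSubGaussian μ (g n) 1) {a : ℕ → ℂ} (ha : Summable fun n => ‖a n‖ ^ 2) :
    ∀ᵐ ω ∂μ, ∃ c, Tendsto (fun N => ∑ i ∈ Finset.range N, a i * g i ω) atTop (𝓝 c) := by
  have key : ∀ k : ℕ, ∀ᵐ ω ∂μ, ∃ N, ∀ M, ‖∑ i ∈ Finset.Ico N M, a i * g i ω‖ ≤ 1 / (k + 1 : ℝ) := by
    intro k
    rw [ae_iff]
    have hb : ∀ t : ℝ, 0 < t → μ {ω | ¬ ∃ N, ∀ M, ‖∑ i ∈ Finset.Ico N M, a i * g i ω‖ ≤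
        1 / (k + 1 : ℝ)} ≤ 4 * ENNReal.ofReal (Real.exp (-(t ^ 2 / 8))) := by
      intro t ht
      have h1 : Tendsto (fun N => ENNReal.ofReal t * tailNorm a N) atTop (𝓝 0) := by
        simpa using ENNReal.Tendsto.const_mul (tendsto_tailNorm ha)
          (Or.inr (ENNReal.ofReal_ne_top (r := t)))
      have h2 : (0 : ℝ≥0∞) < ENNReal.ofReal (1 / (k + 1 : ℝ)) := by
        rw [ENNReal.ofReal_pos]; positivity
      obtain ⟨N, hN⟩ := (h1.eventually (gt_mem_nhds h2)).exists
      refine le_trans (measure_mono ?_) (measure_exists_tail_lt_le hm hi hs hg a N ht)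
      intro ω hω
      simp only [Set.mem_ofPred_eq, not_exists, not_forall, not_le] at hω ⊢
      obtain ⟨M, hM⟩ := hω N
      refine ⟨M, hN.trans ?_⟩
      rw [← ofReal_norm]
      exact (ENNReal.ofReal_lt_ofReal_iff_of_nonneg (by positivity)).2 hM
    have hlim : Tendsto (fun t : ℝ => 4 * ENNReal.ofReal (Real.exp (-(t ^ 2 / 8)))) atTop (𝓝 0) := by
      have h1 : Tendsto (fun t : ℝ => Real.exp (-(t ^ 2 / 8))) atTop (𝓝 0) := by
        refine Real.tendsto_exp_neg_atTop_nhds_zero.comp ?_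
        exact (tendsto_pow_atTop (by norm_num)).atTop_div_const (by norm_num)
      have h2 := ENNReal.Tendsto.const_mul (a := 4) (ENNReal.tendsto_ofReal h1)
        (Or.inr (by simp))
      simpa using h2
    refine le_antisymm (ge_of_tendsto hlim ?_) zero_le
    filter_upwards [eventually_gt_atTop 0] with t ht using hb t ht
  filter_upwards [ae_all_iff.2 key] with ω hω
  refine cauchySeq_tendsto_of_complete ?_
  rw [Metric.cauchySeq_iff']
  intro ε hε
  obtain ⟨k, hk⟩ := exists_nat_one_div_lt hε
  obtain ⟨N, hN⟩ := hω k
  refine ⟨N, fun M hM => ?_⟩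
  rw [dist_eq_norm, ← Finset.sum_Ico_eq_sub _ hM]
  exact (hN M).trans_lt hk

end Series

/-! ### Conditioning on the weights. -/

section Fubini

variable {Ω X Y : Type*} [MeasurableSpace Ω] [MeasurableSpace X] [MeasurableSpace Y]
  {μ : Measure Ω}

/-- Independence makes the joint law a product, so Fubini allows `V` to be frozen while `G` is
resampled. -/
theorem ae_of_indepFun [IsProbabilityMeasure μ] {V : Ω → X} {G : Ω → Y} (hV : Measurable V)
    (hG : Measurable G) (hi : IndepFun V G μ) {S : Set (X × Y)} (hS : MeasurableSet S)
    (h : ∀ᵐ ω ∂μ, ∀ᵐ ω' ∂μ, (V ω, G ω') ∈ S) : ∀ᵐ ω ∂μ, (V ω, G ω) ∈ S := by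
  have hmap := (indepFun_iff_map_prod_eq_prod_map_map hV.aemeasurable hG.aemeasurable).1 hi
  have := Measure.isProbabilityMeasure_map (μ := μ) hV.aemeasurable
  have := Measure.isProbabilityMeasure_map (μ := μ) hG.aemeasurable
  have hS' : MeasurableSet {p | p ∈ S} := hS
  refine (ae_map_iff (hV.prodMk hG).aemeasurable hS').1 ?_
  rw [hmap, Measure.ae_prod_iff_ae_ae hS']
  have hm : MeasurableSet {x | ∀ᵐ y ∂μ.map G, (x, y) ∈ S} := by
    have : {x | ∀ᵐ y ∂μ.map G, (x, y) ∈ S} = (fun x => (μ.map G) (Prod.mk x ⁻¹' Sᶜ)) ⁻¹' {0} := by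
      ext x; simp [ae_iff]; rfl
    rw [this]
    exact measurable_measure_prodMk_left hS.compl (measurableSet_singleton 0)
  rw [ae_map_iff hV.aemeasurable hm]
  filter_upwards [h] with ω hω
  exact (ae_map_iff hG.aemeasurable (measurable_prodMk_left hS)).2 hω

end Fubini

/-! ### Uniform control over pairs, levels and ranks. -/

section UnionBound

variable {Ω : Type*} [MeasurableSpace Ω] {μ : Measure Ω} {ι : Type*} {g : ℕ → Ω → ℂ}

/-- The partial sums of all tails are controlled by `c √(n + 1) √(log (N + 2))` times the
`ℓ²` norm of the tail, for the increments over the pairs in `P n`. -/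
def HasTailControl (P : ℕ → Finset (ι × ι)) (v : ℕ → ι → ℂ) (γ : ℕ → ℂ) (c : ℝ) : Prop :=
  ∀ n, ∀ p ∈ P n, ∀ N M : ℕ, ‖∑ i ∈ Finset.Ico N M, (v i p.1 - v i p.2) * γ i‖ₑ ≤
    ENNReal.ofReal (c * (√(n + 1) * √(Real.log (N + 2)))) *
      tailNorm (fun i => v i p.1 - v i p.2) N

theorem exp_neg_mul_log_pow (n N j : ℕ) :
    Real.exp (-(j * ((n + 1) * Real.log (N + 2)))) = (((N + 2 : ℝ) ^ (n + 1))⁻¹) ^ j := by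
  have h : (0 : ℝ) < N + 2 := by positivity
  rw [Real.exp_neg, inv_pow, Real.exp_nat_mul]
  congr 2
  have := Real.exp_nat_mul (Real.log (N + 2)) (n + 1)
  rw [Real.exp_log h] at this
  rw [← this]; push_cast; rfl

/-- With `q = (N+2)^(-(n+1))`, the power splits by use: `q ^ j₀` absorbs the number `A ^ n` of pairs
and leaves `2⁻ⁿ`, `q ^ 2` gives summability in `N`, and `q ^ i` is at most `2⁻ⁱ`. -/
theorem pow_mul_inv_pow_le {A : ℕ} {j₀ : ℕ} (hj : 2 * A ≤ 2 ^ j₀) (n N i : ℕ) :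
    (A : ℝ) ^ n * (((N + 2 : ℝ) ^ (n + 1))⁻¹) ^ (j₀ + 2 + i) ≤
      (1 / 2) ^ i * ((1 / 2) ^ n * ((N + 2 : ℝ) ^ 2)⁻¹) := by
  set q : ℝ := ((N + 2 : ℝ) ^ (n + 1))⁻¹ with hq
  have hq0 : 0 ≤ q := by positivity
  have hN : (2 : ℝ) ≤ N + 2 := by linarith [Nat.cast_nonneg (α := ℝ) N]
  have h1 : (1 : ℝ) ≤ N + 2 := by linarith
  have hqN : q ≤ (N + 2 : ℝ)⁻¹ := by
    rw [hq]; apply inv_anti₀ (by positivity)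
    calc (N + 2 : ℝ) = (N + 2 : ℝ) ^ 1 := (pow_one _).symm
      _ ≤ _ := pow_le_pow_right₀ h1 (by omega)
  have hq2 : q ≤ 1 / 2 := hqN.trans (by rw [one_div]; exact inv_anti₀ (by norm_num) hN)
  have hqn : q ≤ ((2 : ℝ) ^ n)⁻¹ := by
    rw [hq]; apply inv_anti₀ (by positivity)
    calc (2 : ℝ) ^ n ≤ (N + 2 : ℝ) ^ n := pow_le_pow_left₀ (by norm_num) hN n
      _ ≤ _ := pow_le_pow_right₀ h1 (by omega)
  have hA : (A : ℝ) ^ n * q ^ j₀ ≤ (1 / 2) ^ n := by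
    calc (A : ℝ) ^ n * q ^ j₀ ≤ (A : ℝ) ^ n * (((2 : ℝ) ^ n)⁻¹) ^ j₀ := by gcongr
      _ = ((A : ℝ) / 2 ^ j₀) ^ n := by
        rw [div_pow, div_eq_mul_inv, inv_pow, ← pow_mul, ← pow_mul, mul_comm n j₀]
      _ ≤ (1 / 2) ^ n := by
        refine pow_le_pow_left₀ (by positivity) ?_ n
        rw [div_le_div_iff₀ (by positivity) (by norm_num)]
        have : (2 * A : ℝ) ≤ 2 ^ j₀ := by exact_mod_cast hj
        linarith
  calc (A : ℝ) ^ n * q ^ (j₀ + 2 + i) = q ^ i * (((A : ℝ) ^ n * q ^ j₀) * q ^ 2) := by ring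
    _ ≤ (1 / 2) ^ i * ((1 / 2) ^ n * ((N + 2 : ℝ)⁻¹) ^ 2) := by gcongr
    _ = _ := by rw [inv_pow]

theorem tsum_geometric_inv_sq_ne_top :
    ∑' (n : ℕ) (N : ℕ), ENNReal.ofReal ((1 / 2) ^ n * ((N + 2 : ℝ) ^ 2)⁻¹) ≠ ⊤ := by
  have h1 : Summable fun N : ℕ => ((N + 2 : ℝ) ^ 2)⁻¹ := by
    have := (summable_nat_add_iff 2).2 (Real.summable_nat_pow_inv.2 one_lt_two)
    simpa using this
  have h2 : ∀ n N : ℕ, ENNReal.ofReal ((1 / 2) ^ n * ((N + 2 : ℝ) ^ 2)⁻¹) =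
      ENNReal.ofReal ((1 / 2) ^ n) * ENNReal.ofReal ((N + 2 : ℝ) ^ 2)⁻¹ := fun n N =>
    ENNReal.ofReal_mul (by positivity)
  simp_rw [h2, ENNReal.tsum_mul_left, ENNReal.tsum_mul_right]
  exact ENNReal.mul_ne_top (summable_geometric_two.tsum_ofReal_ne_top) h1.tsum_ofReal_ne_top

/-- The union bound shows that control with constant `8 (j₀ + 2 + i)` fails with probability
`O(2⁻ⁱ)`; failure for every constant is therefore null. -/
theorem ae_exists_hasTailControl_of_const [IsProbabilityMeasure μ] (hm : ∀ n, Measurable (g n))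
    (hi : iIndepFun g μ) (hs : ∀ n, IdentDistrib (g n) (fun ω => -g n ω) μ μ)
    (hg : ∀ n, IsSubGaussian μ (g n) 1) {P : ℕ → Finset (ι × ι)} {A B : ℕ}
    (hP : ∀ n, (P n).card ≤ B * A ^ n) (v : ℕ → ι → ℂ) :
    ∀ᵐ ω ∂μ, ∃ k : ℕ, HasTailControl P v (fun i => g i ω) k := by
  obtain ⟨j₀, hj₀⟩ := pow_unbounded_of_one_lt (2 * A) one_lt_two
  set S := ∑' (n : ℕ) (N : ℕ), ENNReal.ofReal ((1 / 2) ^ n * ((N + 2 : ℝ) ^ 2)⁻¹) with hS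
  have hbad : ∀ i : ℕ, μ {ω | ¬ ∃ k : ℕ, HasTailControl P v (fun i => g i ω) k} ≤
      ENNReal.ofReal (B * 4 * (1 / 2) ^ i) * S := by
    intro i
    -- Large enough that `k² / 8 ≥ j₀ + 2 + i`, the power of `(N+2)^(-(n+1))` wanted from the
    -- Gaussian tail.
    set k : ℕ := 8 * (j₀ + 2 + i) with hk
    have hsub : {ω | ¬ ∃ k : ℕ, HasTailControl P v (fun i => g i ω) k} ⊆
        ⋃ n : ℕ, ⋃ N : ℕ, ⋃ p ∈ P n, {ω | ∃ M,
          ENNReal.ofReal ((k : ℝ) * (√(n + 1) * √(Real.log (N + 2)))) *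
            tailNorm (fun i => v i p.1 - v i p.2) N <
            ‖∑ i ∈ Finset.Ico N M, (v i p.1 - v i p.2) * g i ω‖ₑ} := by
      intro ω hω
      simp only [Set.mem_ofPred_eq, not_exists] at hω
      have := hω k
      simp only [HasTailControl, not_forall, not_le] at this
      obtain ⟨n, p, hp, N, M, h⟩ := this
      simp only [Set.mem_iUnion]
      exact ⟨n, N, p, hp, M, h⟩
    refine (measure_mono hsub).trans ((measure_iUnion_le _).trans ?_)
    rw [hS, ← ENNReal.tsum_mul_left]
    refine ENNReal.tsum_le_tsum fun n => (measure_iUnion_le _).trans ?_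
    rw [← ENNReal.tsum_mul_left]
    refine ENNReal.tsum_le_tsum fun N => (measure_biUnion_finset_le _ _).trans ?_
    have hlog : 0 < Real.log (N + 2) := Real.log_pos (by linarith [Nat.cast_nonneg (α := ℝ) N])
    have ht : 0 < (k : ℝ) * (√(n + 1) * √(Real.log (N + 2))) := by
      have : (0 : ℝ) < k := by rw [hk]; positivity
      positivity
    refine (Finset.sum_le_card_nsmul _ _ _ fun p _ =>
      measure_exists_tail_lt_le hm hi hs hg _ N ht).trans ?_
    rw [nsmul_eq_mul, ← ENNReal.ofReal_natCast, show (4 : ℝ≥0∞) = ENNReal.ofReal 4 by simp,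
      ← ENNReal.ofReal_mul (by positivity), ← ENNReal.ofReal_mul (by positivity),
      ← ENNReal.ofReal_mul (by positivity)]
    refine ENNReal.ofReal_le_ofReal ?_
    have hexp : Real.exp (-(((k : ℝ) * (√(n + 1) * √(Real.log (N + 2)))) ^ 2 / 8)) ≤
        (((N + 2 : ℝ) ^ (n + 1))⁻¹) ^ (j₀ + 2 + i) := by
      rw [← exp_neg_mul_log_pow, Real.exp_le_exp, neg_le_neg_iff, mul_pow, mul_pow,
        Real.sq_sqrt (by positivity), Real.sq_sqrt hlog.le]
      have : ((j₀ + 2 + i : ℕ) : ℝ) ≤ (k : ℝ) ^ 2 / 8 := by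
        have h1 : (1 : ℝ) ≤ ((j₀ + 2 + i : ℕ) : ℝ) := by exact_mod_cast (by omega)
        have h2 : (k : ℝ) = 8 * ((j₀ + 2 + i : ℕ) : ℝ) := by rw [hk]; push_cast; ring
        rw [h2]; nlinarith
      calc _ ≤ (k : ℝ) ^ 2 / 8 * ((n + 1) * Real.log (N + 2)) := by gcongr
        _ = _ := by ring
    have hc : ((P n).card : ℝ) ≤ B * (A : ℝ) ^ n := by exact_mod_cast hP n
    calc _ ≤ (B * (A : ℝ) ^ n) * (4 * (((N + 2 : ℝ) ^ (n + 1))⁻¹) ^ (j₀ + 2 + i)) := by gcongr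
      _ = B * 4 * ((A : ℝ) ^ n * (((N + 2 : ℝ) ^ (n + 1))⁻¹) ^ (j₀ + 2 + i)) := by ring
      _ ≤ B * 4 * ((1 / 2) ^ i * ((1 / 2) ^ n * ((N + 2 : ℝ) ^ 2)⁻¹)) :=
        mul_le_mul_of_nonneg_left (pow_mul_inv_pow_le hj₀.le n N i) (by positivity)
      _ = _ := by ring
  rw [ae_iff]
  have hlim : Tendsto (fun i : ℕ => ENNReal.ofReal (B * 4 * (1 / 2) ^ i) * S) atTop (𝓝 0) := by
    have h1 : Tendsto (fun i : ℕ => (B * 4 * (1 / 2) ^ i : ℝ)) atTop (𝓝 0) := by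
      simpa using (tendsto_pow_atTop_nhds_zero_of_lt_one (r := (1 / 2 : ℝ)) (by norm_num)
        (by norm_num)).const_mul (B * 4 : ℝ)
    have h2 := ENNReal.Tendsto.mul_const (b := S) (ENNReal.tendsto_ofReal h1)
      (Or.inr tsum_geometric_inv_sq_ne_top)
    rwa [ENNReal.ofReal_zero, zero_mul] at h2
  exact le_antisymm (ge_of_tendsto' hlim hbad) zero_le

theorem measurable_tailNorm {X : Type*} [MeasurableSpace X] {a : X → ℕ → ℂ}
    (ha : ∀ n, Measurable fun x => a x n) (N : ℕ) : Measurable fun x => tailNorm (a x) N := by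
  unfold tailNorm
  exact (Measurable.tsum fun n => ((ha _).enorm.pow_const 2)).pow_const _

theorem measurableSet_hasTailControl (P : ℕ → Finset (ι × ι)) (c : ℝ) :
    MeasurableSet {z : (ℕ → ι → ℂ) × (ℕ → ℂ) | HasTailControl P z.1 z.2 c} := by
  have hv : ∀ i x, Measurable fun z : (ℕ → ι → ℂ) × (ℕ → ℂ) => z.1 i x := fun i x =>
    (measurable_pi_apply x).comp ((measurable_pi_apply i).comp measurable_fst)
  have hγ : ∀ i, Measurable fun z : (ℕ → ι → ℂ) × (ℕ → ℂ) => z.2 i := fun i =>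
    (measurable_pi_apply i).comp measurable_snd
  simp only [HasTailControl, Set.ofPred_forall]
  refine MeasurableSet.iInter fun n => Finset.measurableSet_biInter _ fun p _ =>
    MeasurableSet.iInter fun N => MeasurableSet.iInter fun M => measurableSet_le ?_ ?_
  · exact (Finset.measurable_sum _ fun i _ => ((hv i _).sub (hv i _)).mul (hγ i)).enorm
  · exact (measurable_tailNorm (fun i => (hv i _).sub (hv i _)) N).const_mul _

variable {d : ℕ} {K : Set (Euc d)} {W : ℕ → K → Ω → ℂ}

theorem IsCondSubGaussian.ae_exists_hasTailControl [IsProbabilityMeasure μ]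
    (h : IsCondSubGaussian μ W g) {P : ℕ → Finset (K × K)} {A B : ℕ}
    (hP : ∀ n, (P n).card ≤ B * A ^ n) :
    ∀ᵐ ω ∂μ, ∃ k : ℕ, HasTailControl P (fun n x => W n x ω) (fun i => g i ω) k := by
  have hS : MeasurableSet {z : (ℕ → K → ℂ) × (ℕ → ℂ) | ∃ k : ℕ, HasTailControl P z.1 z.2 k} := by
    rw [Set.ofPred_exists]
    exact MeasurableSet.iUnion fun k => measurableSet_hasTailControl P k
  refine ae_of_indepFun (V := fun ω n x => W n x ω) (G := fun ω n => g n ω) ?_ ?_ h.indep_W_g hS ?_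
  · exact measurable_pi_lambda _ fun n => measurable_pi_lambda _ fun x => h.measurable_W n x
  · exact measurable_pi_lambda _ h.measurable_g
  · exact ae_of_all _ fun ω => ae_exists_hasTailControl_of_const h.measurable_g h.indep_g
      h.symmetric_g h.subGaussian_g hP _

theorem IsCondSubGaussian.ae_exists_tendsto [IsProbabilityMeasure μ]
    (h : IsCondSubGaussian μ W g) (x : K) :
    ∀ᵐ ω ∂μ, ∃ c, Tendsto (fun N => partialSum W g N x ω) atTop (𝓝 c) := by
  have hS : MeasurableSet {z : (ℕ → K → ℂ) × (ℕ → ℂ) |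
      ∃ c, Tendsto (fun N => ∑ i ∈ Finset.range N, z.1 i x * z.2 i) atTop (𝓝 c)} := by
    have hv : ∀ i x, Measurable fun z : (ℕ → K → ℂ) × (ℕ → ℂ) => z.1 i x := fun i x =>
      (measurable_pi_apply x).comp ((measurable_pi_apply i).comp measurable_fst)
    have hγ : ∀ i, Measurable fun z : (ℕ → K → ℂ) × (ℕ → ℂ) => z.2 i := fun i =>
      (measurable_pi_apply i).comp measurable_snd
    exact measurableSet_exists_tendsto fun N =>
      Finset.measurable_sum _ fun i _ => (hv i _).mul (hγ i)
  refine ae_of_indepFun (V := fun ω n x => W n x ω) (G := fun ω n => g n ω) ?_ ?_ h.indep_W_g hS ?_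
  · exact measurable_pi_lambda _ fun n => measurable_pi_lambda _ fun x => h.measurable_W n x
  · exact measurable_pi_lambda _ h.measurable_g
  · filter_upwards [h.summable_W x] with ω hω
    exact ae_exists_tendsto_sum h.measurable_g h.indep_g h.symmetric_g h.subGaussian_g hω

end UnionBound

/-! ### Calculus of the moduli `u ^ β * log ^ e`. -/

section Modulus

/-- The sign of `e` decides which of the two bounds is relevant; adding both constants avoids later
case distinctions. -/
theorem rpow_le_of_comparable {c C s t : ℝ} (hc : 0 < c) (hs : 0 < s) (h1 : c * s ≤ t)
    (h2 : t ≤ C * s) (e : ℝ) : t ^ e ≤ (c ^ e + C ^ e) * s ^ e := by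
  have ht : 0 < t := (mul_pos hc hs).trans_le h1
  have hC : 0 < C := pos_of_mul_pos_left (ht.trans_le h2) hs.le
  rw [add_mul]
  have hp1 : 0 ≤ c ^ e * s ^ e := by positivity
  have hp2 : 0 ≤ C ^ e * s ^ e := by positivity
  rcases le_total 0 e with he | he
  · have := Real.rpow_le_rpow ht.le h2 he
    rw [Real.mul_rpow hC.le hs.le] at this
    linarith
  · have := Real.rpow_le_rpow_of_nonpos (mul_pos hc hs) h1 he
    rw [Real.mul_rpow hc.le hs.le] at this
    linarith

theorem exists_exp_mul_rpow_le {β : ℝ} (hβ : 0 < β) (e : ℝ) :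
    ∃ C : ℝ, 0 < C ∧ ∀ s : ℝ, 0 ≤ s → Real.exp (-(β * s)) * (1 + s) ^ e ≤ C := by
  obtain ⟨m, hm⟩ := exists_nat_ge e
  refine ⟨m.factorial * Real.exp β / β ^ m, by positivity, fun s hs => ?_⟩
  have h1 : (1 + s) ^ e ≤ (1 + s) ^ m := by
    rw [← Real.rpow_natCast]
    exact Real.rpow_le_rpow_of_exponent_le (by linarith) hm
  have h2 := Real.pow_div_factorial_le_exp (β * (1 + s)) (by positivity) m
  have h3 : Real.exp (β * (1 + s)) = Real.exp β * Real.exp (β * s) := by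
    rw [← Real.exp_add]; ring_nf
  rw [h3, div_le_iff₀ (by positivity), mul_pow] at h2
  rw [Real.exp_neg, le_div_iff₀ (by positivity), inv_mul_eq_div, div_mul_eq_mul_div,
    div_le_iff₀ (Real.exp_pos _)]
  calc (1 + s) ^ e * β ^ m ≤ (1 + s) ^ m * β ^ m := by gcongr
    _ = β ^ m * (1 + s) ^ m := by ring
    _ ≤ _ := h2
    _ = _ := by ring

theorem half_pow_rpow (n : ℕ) (β : ℝ) :
    ((1 / 2 : ℝ) ^ n) ^ β = Real.exp (-(β * (n * Real.log 2))) := by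
  rw [← Real.rpow_natCast, ← Real.rpow_mul (by norm_num), Real.rpow_def_of_pos (by norm_num),
    one_div, Real.log_inv]
  congr 1; ring

theorem log_two_mem : 0 < Real.log 2 ∧ Real.log 2 ≤ 1 :=
  ⟨Real.log_pos one_lt_two, by linarith [Real.log_two_lt_d9]⟩

/-- The value at the scale `2⁻ⁿ` of the modulus with exponent `β` and logarithmic exponent `e`. -/
def dyadicModulus (β e : ℝ) (n : ℕ) : ℝ := ((1 / 2 : ℝ) ^ n) ^ β * (n + 1 : ℝ) ^ e

theorem dyadicModulus_pos (β e : ℝ) (n : ℕ) : 0 < dyadicModulus β e n := by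
  unfold dyadicModulus; positivity

/-- A net pair at level `n` may be far closer than `2⁻ⁿ`, so its logarithm may be much larger than
`n`. The surplus `s` costs at most a power of `1 + s` in the logarithm, while `u ^ β` gains `exp (-β
s)`. -/
theorem exists_rpow_mul_abs_log_le {β : ℝ} (hβ : 0 < β) (e : ℝ) {A : ℝ} (hA : 1 ≤ A) :
    ∃ C : ℝ, 0 < C ∧ ∀ (n : ℕ) (u : ℝ), 0 < u → u ≤ A * (1 / 2) ^ n → u ≤ 1 / 2 →
      u ^ β * |Real.log u| ^ e ≤ C * dyadicModulus β e n := by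
  obtain ⟨C₀, hC₀, h₀⟩ := exists_exp_mul_rpow_le hβ e
  obtain ⟨hl, hl1⟩ := log_two_mem
  set l := Real.log 2 with hldef
  set a := Real.log A with ha
  have ha0 : 0 ≤ a := Real.log_nonneg hA
  -- From `n l ≤ L + a` and `l ≤ L`: `(n + 1) l ≤ 2 L + a ≤ L (2 + a / l)`, that is `c (n + 1) ≤ L`.
  set c := l / (2 + a / l) with hc
  have hc0 : 0 < c := by positivity
  refine ⟨Real.exp (β * a) * (c ^ e + C₀), by positivity, fun n u hu hun hu2 => ?_⟩
  set L := -Real.log u with hL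
  have hLl : l ≤ L := by
    have := Real.log_le_log hu hu2
    rw [one_div, Real.log_inv] at this
    linarith
  have hLn : n * l ≤ L + a := by
    have := Real.log_le_log hu hun
    rw [Real.log_mul (by positivity) (by positivity), Real.log_pow, one_div, Real.log_inv] at this
    linarith
  have habs : |Real.log u| = L := by
    rw [hL, abs_of_nonpos]; linarith
  set s := L + a - n * l with hs
  have hs0 : 0 ≤ s := by linarith
  have hub : u ^ β = Real.exp (-(β * s)) * Real.exp (β * a) * ((1 / 2 : ℝ) ^ n) ^ β := by
    rw [Real.rpow_def_of_pos hu, half_pow_rpow, ← Real.exp_add, ← Real.exp_add]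
    congr 1; rw [hs, hL]; ring
  have h1 : c * (n + 1 : ℝ) ≤ L := by
    rw [hc, div_mul_eq_mul_div, div_le_iff₀ (by positivity)]
    have : a ≤ L * (a / l) := by
      rw [mul_div_assoc', le_div_iff₀ hl]; nlinarith
    nlinarith
  have h2 : L ≤ (1 + s) * (n + 1 : ℝ) := by
    have hn : (0 : ℝ) ≤ n := Nat.cast_nonneg n
    have : L ≤ s + n * l := by linarith
    nlinarith [mul_nonneg hs0 hn]
  have h3 := rpow_le_of_comparable hc0 (by positivity) h1 h2 e
  have h4 := h₀ s hs0
  rw [habs, hub, dyadicModulus]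
  have h5 : Real.exp (-(β * s)) ≤ 1 := Real.exp_le_one_iff.2 (by nlinarith)
  calc _ ≤ Real.exp (-(β * s)) * Real.exp (β * a) * ((1 / 2 : ℝ) ^ n) ^ β *
        ((c ^ e + (1 + s) ^ e) * (n + 1 : ℝ) ^ e) := by gcongr
    _ = Real.exp (β * a) * (Real.exp (-(β * s)) * c ^ e + Real.exp (-(β * s)) * (1 + s) ^ e) *
        (((1 / 2 : ℝ) ^ n) ^ β * (n + 1 : ℝ) ^ e) := by ring
    _ ≤ Real.exp (β * a) * (1 * c ^ e + C₀) *
        (((1 / 2 : ℝ) ^ n) ^ β * (n + 1 : ℝ) ^ e) := by gcongr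
    _ = _ := by rw [one_mul]

/-- Half of the decay `2 ^ (-β k)` absorbs the polynomial factor `(1 + k) ^ e`; the other half is
summed as a geometric series of ratio `r = 2 ^ (-β / 2)`. -/
theorem exists_sum_dyadicModulus_le {β : ℝ} (hβ : 0 < β) (e : ℝ) :
    ∃ C : ℝ, 0 < C ∧ ∀ n m : ℕ,
      ∑ k ∈ Finset.range m, dyadicModulus β e (n + k) ≤ C * dyadicModulus β e n := by
  obtain ⟨hl, hl1⟩ := log_two_mem
  obtain ⟨C₀, hC₀, h₀⟩ := exists_exp_mul_rpow_le (β := β * Real.log 2 / 2) (by positivity) e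
  set r := Real.exp (-(β * Real.log 2 / 2)) with hr
  have hr0 : 0 < r := Real.exp_pos _
  have hr1 : r < 1 := Real.exp_lt_one_iff.2 (by have := mul_pos hβ hl; linarith)
  have hg := summable_geometric_of_lt_one hr0.le hr1
  refine ⟨(1 + C₀) * ∑' k : ℕ, r ^ k, mul_pos (by positivity) ?_, fun n m => ?_⟩
  · exact hg.tsum_pos (fun k => by positivity) 0 (by simp)
  have hterm : ∀ k : ℕ, dyadicModulus β e (n + k) ≤ ((1 + C₀) * r ^ k) * dyadicModulus β e n := by
    intro k
    have h1 : (1 : ℝ) * (n + 1 : ℝ) ≤ ((n + k : ℕ) : ℝ) + 1 := by push_cast; linarith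
    have h2 : ((n + k : ℕ) : ℝ) + 1 ≤ (1 + k) * (n + 1 : ℝ) := by
      push_cast; nlinarith [mul_nonneg (Nat.cast_nonneg (α := ℝ) n) (Nat.cast_nonneg (α := ℝ) k)]
    have h3 := rpow_le_of_comparable one_pos (by positivity) h1 h2 e
    have hk := h₀ k (Nat.cast_nonneg k)
    have hrk : r ^ k = Real.exp (-(β * Real.log 2 / 2 * k)) := by
      rw [hr, ← Real.exp_nat_mul]; congr 1; ring
    have hrk1 : r ^ k ≤ 1 := pow_le_one₀ hr0.le hr1.le
    have hpow : ((1 / 2 : ℝ) ^ (n + k)) ^ β = ((1 / 2 : ℝ) ^ n) ^ β * (r ^ k * r ^ k) := by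
      rw [half_pow_rpow, half_pow_rpow, hrk, ← Real.exp_add, ← Real.exp_add]
      congr 1; push_cast; ring
    rw [← hrk] at hk
    rw [Real.one_rpow] at h3
    unfold dyadicModulus
    rw [hpow]
    calc _ ≤ ((1 / 2 : ℝ) ^ n) ^ β * (r ^ k * r ^ k) *
          ((1 + (1 + k : ℝ) ^ e) * (n + 1 : ℝ) ^ e) := by gcongr
      _ = (r ^ k + r ^ k * (1 + k : ℝ) ^ e) * r ^ k *
          (((1 / 2 : ℝ) ^ n) ^ β * (n + 1 : ℝ) ^ e) := by ring
      _ ≤ (1 + C₀) * r ^ k * (((1 / 2 : ℝ) ^ n) ^ β * (n + 1 : ℝ) ^ e) := by gcongr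
  calc _ ≤ ∑ k ∈ Finset.range m, ((1 + C₀) * r ^ k) * dyadicModulus β e n :=
        Finset.sum_le_sum fun k _ => hterm k
    _ = (1 + C₀) * (∑ k ∈ Finset.range m, r ^ k) * dyadicModulus β e n := by
        rw [← Finset.sum_mul, ← Finset.mul_sum]
    _ ≤ _ := by
        have := hg.sum_le_tsum (Finset.range m) (fun k _ => by positivity)
        have := dyadicModulus_pos β e n
        gcongr

/-- The modulus `u ↦ u ^ β * log (1 + u⁻¹) ^ e`. -/
def logModulus (β e u : ℝ) : ℝ := u ^ β * Real.log (1 + u⁻¹) ^ e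

theorem log_one_add_inv_pos {u : ℝ} (hu : 0 < u) : 0 < Real.log (1 + u⁻¹) :=
  Real.log_pos (by have := inv_pos.2 hu; linarith)

theorem logModulus_nonneg {u : ℝ} (β e : ℝ) (hu : 0 ≤ u) : 0 ≤ logModulus β e u := by
  have : 0 ≤ Real.log (1 + u⁻¹) := Real.log_nonneg (by have := inv_nonneg.2 hu; linarith)
  unfold logModulus; positivity

theorem logModulus_pos {u : ℝ} (β e : ℝ) (hu : 0 < u) : 0 < logModulus β e u := by
  have := log_one_add_inv_pos hu
  unfold logModulus; positivity

theorem logModulus_zero {β : ℝ} (hβ : 0 < β) (e : ℝ) : logModulus β e 0 = 0 := by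
  rw [logModulus, Real.zero_rpow hβ.ne', zero_mul]

theorem exists_dyadicModulus_le {β : ℝ} (hβ : 0 < β) (e : ℝ) :
    ∃ C : ℝ, 0 < C ∧ ∀ (n : ℕ) (u : ℝ), (1 / 2) ^ (n + 1) < u → u ≤ (1 / 2) ^ n →
      dyadicModulus β e n ≤ C * logModulus β e u := by
  obtain ⟨hl, hl1⟩ := log_two_mem
  set l := Real.log 2 with hldef
  refine ⟨2 ^ β * ((1 / 2) ^ e + (2 / l) ^ e), by positivity, fun n u hu1 hu2 => ?_⟩
  have hu : 0 < u := lt_trans (by positivity) hu1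
  have hφ := log_one_add_inv_pos hu
  set φ := Real.log (1 + u⁻¹) with hφdef
  have hn : (0 : ℝ) ≤ n := Nat.cast_nonneg n
  have hinv1 : (2 : ℝ) ^ n ≤ u⁻¹ := by
    have := inv_anti₀ hu hu2
    simpa using this
  have hinv2 : u⁻¹ ≤ (2 : ℝ) ^ (n + 1) := by
    have := inv_anti₀ (by positivity) hu1.le
    simpa using this
  have h1 : φ ≤ 2 * (n + 1) := by
    have h2p : (1 : ℝ) ≤ 2 ^ (n + 1) := one_le_pow₀ one_le_two
    have : φ ≤ Real.log (2 ^ (n + 2)) := by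
      apply Real.log_le_log (by positivity)
      rw [pow_succ]; linarith
    rw [Real.log_pow] at this
    push_cast at this
    nlinarith
  have h2 : l / 2 * (n + 1) ≤ φ := by
    rcases Nat.eq_zero_or_pos n with rfl | hnpos
    · have : l ≤ φ := Real.log_le_log (by norm_num) (by simp at hinv1; linarith)
      simp; linarith
    · have : Real.log (2 ^ n) ≤ φ := Real.log_le_log (by positivity) (by linarith)
      rw [Real.log_pow] at this
      have : (1 : ℝ) ≤ n := by exact_mod_cast hnpos
      nlinarith
  have h3 : (n + 1 : ℝ) ^ e ≤ ((1 / 2) ^ e + (2 / l) ^ e) * φ ^ e := by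
    refine rpow_le_of_comparable (by norm_num) hφ (by linarith) ?_ e
    rw [div_mul_eq_mul_div, le_div_iff₀ hl]; linarith
  have h4 : ((1 / 2 : ℝ) ^ n) ^ β ≤ 2 ^ β * u ^ β := by
    rw [← Real.mul_rpow (by norm_num) hu.le]
    refine Real.rpow_le_rpow (by positivity) ?_ hβ.le
    rw [pow_succ] at hu1; linarith
  unfold dyadicModulus logModulus
  calc _ ≤ (2 ^ β * u ^ β) * (((1 / 2) ^ e + (2 / l) ^ e) * φ ^ e) := by gcongr
    _ = _ := by ring

/-- For `e ≤ 0` both factors are largest at `U`. For `e > 0`, `log v ≤ v ^ ε / ε` with `ε = β / e`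
bounds the modulus by a multiple of `(u (1 + u⁻¹)) ^ β = (u + 1) ^ β`. -/
theorem exists_logModulus_le {β : ℝ} (hβ : 0 < β) (e : ℝ) {U : ℝ} (hU : 0 < U) :
    ∃ C : ℝ, 0 < C ∧ ∀ u : ℝ, 0 ≤ u → u ≤ U → logModulus β e u ≤ C := by
  have hφU := log_one_add_inv_pos hU
  suffices h : ∃ C : ℝ, 0 < C ∧ ∀ u : ℝ, 0 < u → u ≤ U → logModulus β e u ≤ C by
    obtain ⟨C, hC, h⟩ := h
    refine ⟨C, hC, fun u hu huU => ?_⟩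
    rcases hu.eq_or_lt with rfl | hu
    · rw [logModulus_zero hβ]; exact hC.le
    · exact h u hu huU
  rcases le_or_gt e 0 with he | he
  · refine ⟨U ^ β * Real.log (1 + U⁻¹) ^ e, by positivity, fun u hu huU => ?_⟩
    unfold logModulus
    have h1 : Real.log (1 + U⁻¹) ≤ Real.log (1 + u⁻¹) :=
      Real.log_le_log (by positivity) (by have := inv_anti₀ hu huU; linarith)
    have := Real.rpow_le_rpow_of_nonpos hφU h1 he
    have := Real.rpow_le_rpow hu.le huU hβ.le
    have := log_one_add_inv_pos hu
    gcongr
  · set ε := β / e with hε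
    have hε0 : 0 < ε := div_pos hβ he
    refine ⟨(U + 1) ^ β / ε ^ e, by positivity, fun u hu huU => ?_⟩
    have h1 := Real.log_le_rpow_div (x := 1 + u⁻¹) (by positivity) hε0
    have h2 := Real.rpow_le_rpow (log_one_add_inv_pos hu).le h1 he.le
    rw [Real.div_rpow (by positivity) hε0.le, ← Real.rpow_mul (by positivity),
      show ε * e = β by rw [hε]; field_simp] at h2
    unfold logModulus
    calc _ ≤ u ^ β * ((1 + u⁻¹) ^ β / ε ^ e) := by gcongr
      _ = (u * (1 + u⁻¹)) ^ β / ε ^ e := by rw [Real.mul_rpow hu.le (by positivity)]; ring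
      _ = (u + 1) ^ β / ε ^ e := by congr 2; field_simp
      _ ≤ _ := by gcongr

/-- Half of the exponent `β` keeps the logarithm bounded; the remaining `u ^ (β / 2)` tends to zero.
-/
theorem tendsto_logModulus {β : ℝ} (hβ : 0 < β) (e : ℝ) :
    ∀ ε > 0, ∃ δ > 0, ∀ u, 0 ≤ u → u ≤ δ → logModulus β e u < ε := by
  intro ε hε
  obtain ⟨C, hC, h⟩ := exists_logModulus_le (half_pos hβ) e one_pos
  have h1 : Tendsto (fun u : ℝ => C * u ^ (β / 2)) (𝓝 0) (𝓝 0) := by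
    have h2 : ContinuousAt (fun u : ℝ => C * u ^ (β / 2)) 0 :=
      (Real.continuousAt_rpow_const _ _ (Or.inr (half_pos hβ).le)).const_mul C
    have h3 := h2.tendsto
    rwa [Real.zero_rpow (half_pos hβ).ne', mul_zero] at h3
  obtain ⟨δ, hδ, hd⟩ := Metric.eventually_nhds_iff.1 (h1.eventually (gt_mem_nhds hε))
  refine ⟨min (δ / 2) 1, by positivity, fun u hu hu2 => ?_⟩
  have hlt : C * u ^ (β / 2) < ε := hd (by
    rw [Real.dist_eq, sub_zero, abs_of_nonneg hu]
    linarith [hu2.trans (min_le_left _ _)])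
  rcases hu.eq_or_lt with rfl | hu'
  · rw [logModulus_zero hβ]; exact hε
  have h4 := h u hu (hu2.trans (min_le_right _ _))
  refine lt_of_le_of_lt ?_ hlt
  unfold logModulus at h4 ⊢
  calc u ^ β * Real.log (1 + u⁻¹) ^ e =
        (u ^ (β / 2) * Real.log (1 + u⁻¹) ^ e) * u ^ (β / 2) := by
        rw [show u ^ β = u ^ (β / 2) * u ^ (β / 2) by rw [← Real.rpow_add hu']; ring_nf]; ring
    _ ≤ _ := by gcongr

theorem exists_le_logModulus (β e : ℝ) {u₀ : ℝ} (hu₀ : 0 < u₀) (U : ℝ) :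
    ∃ c : ℝ, 0 < c ∧ ∀ u, u₀ ≤ u → u ≤ U → c ≤ logModulus β e u := by
  by_cases hne : u₀ ≤ U
  · have hc : ContinuousOn (logModulus β e) (Set.Icc u₀ U) := by
      intro u hu
      have h0 : 0 < u := hu₀.trans_le hu.1
      have hφ := log_one_add_inv_pos h0
      have h1 : ContinuousAt (fun u : ℝ => 1 + u⁻¹) u :=
        continuousAt_const.add (continuousAt_inv₀ h0.ne')
      have h2 := h1.log (by positivity)
      exact ((Real.continuousAt_rpow_const _ _ (Or.inl h0.ne')).mul
        (h2.rpow_const (Or.inl hφ.ne'))).continuousWithinAt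
    obtain ⟨x, hx, hmin⟩ := isCompact_Icc.exists_isMinOn ⟨u₀, le_rfl, hne⟩ hc
    exact ⟨logModulus β e x, logModulus_pos _ _ (hu₀.trans_le hx.1), fun u h1 h2 => hmin ⟨h1, h2⟩⟩
  · exact ⟨1, one_pos, fun u h1 h2 => absurd (h1.trans h2) hne⟩

end Modulus

/-! ### Deterministic chaining for a quasi-metric. -/

section Chaining

variable {X : Type*} [MetricSpace X]

/-- Finite subsets of `T` approximating every point of `T` within `2⁻ⁿ`, both for the distance
and for `ρ`. -/
structure IsNetFamily (ρ : X → X → ℝ) (T : Set X) (D : ℕ → Finset X) : Prop where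
  subset : ∀ n, ↑(D n) ⊆ T
  exists_near : ∀ n, ∀ x ∈ T, ∃ y ∈ D n, dist x y ≤ (1 / 2) ^ n ∧ ρ x y ≤ (1 / 2) ^ n

/-- The pairs of points of two consecutive nets. -/
def netPairs [DecidableEq X] (D : ℕ → Finset X) (n : ℕ) : Finset (X × X) :=
  (D n ∪ D (n + 1)) ×ˢ (D n ∪ D (n + 1))

variable [DecidableEq X] {ρ : X → X → ℝ} {T : Set X} {D : ℕ → Finset X}

/-- The increments of `F` over close pairs of consecutive nets are at most
`B √(n + 1) ρ ^ β |log ρ| ^ η`. -/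
def HasNetIncrements (ρ : X → X → ℝ) (D : ℕ → Finset X) (β η δ B : ℝ) (F : X → ℂ) : Prop :=
  ∀ n, ∀ p ∈ netPairs D n, dist p.1 p.2 ≤ δ → 0 < ρ p.1 p.2 → ρ p.1 p.2 ≤ 1 / 2 →
    ‖F p.1 - F p.2‖ ≤ B * (√(n + 1) * (ρ p.1 p.2 ^ β * |Real.log (ρ p.1 p.2)| ^ η))

/-- Join `x` and `y` through their nearby net points, starting at the level `n` with `ρ x y ≈ 2⁻ⁿ`.
Link bounds decay geometrically up to a power of `n`, so the first level dominates. The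
quasi-triangle inequality is used only inside single links, where it costs at most `3 κ²`; the links
are summed in `ℂ`. The constants precede `F`, which makes the estimate uniform over all `S_M - S_N`.
-/
theorem exists_local_logModulus (h0 : ∀ x y, 0 ≤ ρ x y) (hf : ∀ x y, ρ x y = 0 ↔ x = y)
    (hsym : ∀ x y, ρ x y = ρ y x) {κ : ℝ} (hκ : 1 ≤ κ)
    (htri : ∀ x y z, ρ x z ≤ κ * (ρ x y + ρ y z))
    (hcont : ∀ ε > 0, ∃ δ > 0, ∀ x y, dist x y ≤ δ → ρ x y ≤ ε)
    (hD : IsNetFamily ρ T D) {β : ℝ} (hβ : 0 < β) (η : ℝ) {δ : ℝ} (hδ : 0 < δ) :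
    ∃ C > 0, ∃ δ' > 0, ∀ F : X → ℂ, Continuous F → ∀ B, 0 ≤ B →
      HasNetIncrements ρ D β η δ B F → ∀ x ∈ T, ∀ y ∈ T, dist x y ≤ δ' →
        ‖F x - F y‖ ≤ C * B * logModulus β (η + 1 / 2) (ρ x y) := by
  set A : ℝ := 3 * κ ^ 2 with hA
  have hκ2 : κ ≤ κ ^ 2 := by nlinarith
  have hA1 : 1 ≤ A := by nlinarith
  obtain ⟨C₁, hC₁, h₁⟩ := exists_rpow_mul_abs_log_le hβ η hA1
  obtain ⟨C₂, hC₂, h₂⟩ := exists_sum_dyadicModulus_le hβ (η + 1 / 2)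
  obtain ⟨C₃, hC₃, h₃⟩ := exists_dyadicModulus_le hβ (η + 1 / 2)
  have hhalf : Tendsto (fun n : ℕ => (1 / 2 : ℝ) ^ n) atTop (𝓝 0) :=
    tendsto_pow_atTop_nhds_zero_of_lt_one (by norm_num) (by norm_num)
  -- From level `n₀` on, every link has `ρ ≤ 1/2`, away from the zero of the logarithm, and length
  -- at most `δ`; the factor `3` serves the middle link, with two projections and the distance from
  -- `x` to `y`.
  obtain ⟨n₀, hn₀A, hn₀δ⟩ : ∃ n₀ : ℕ, A * (1 / 2) ^ n₀ ≤ 1 / 2 ∧ 3 * (1 / 2) ^ n₀ ≤ δ := by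
    have h1 : ∀ᶠ n : ℕ in atTop, (1 / 2 : ℝ) ^ n < min (1 / 2 / A) (δ / 3) :=
      hhalf.eventually (gt_mem_nhds (by positivity))
    obtain ⟨n, hn⟩ := h1.exists
    have ha := (lt_min_iff.1 hn).1
    have hb := (lt_min_iff.1 hn).2
    rw [lt_div_iff₀ (by positivity)] at ha hb
    exact ⟨n, by linarith, by linarith⟩
  obtain ⟨δ₁, hδ₁, hρ⟩ := hcont ((1 / 2) ^ n₀) (by positivity)
  refine ⟨C₁ * (2 * C₂ + 1) * C₃, by positivity, min δ₁ ((1 / 2) ^ n₀), by positivity, ?_⟩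
  intro F hF B hB hinc x hx y hy hxy
  choose! π hπD hπd hπρ using hD.exists_near
  set θ := dyadicModulus β (η + 1 / 2) with hθ
  have hmono : ∀ n, n₀ ≤ n → (1 / 2 : ℝ) ^ n ≤ (1 / 2) ^ n₀ := fun n hn =>
    pow_le_pow_of_le_one (by norm_num) (by norm_num) hn
  have link : ∀ n, n₀ ≤ n → ∀ p ∈ D n ∪ D (n + 1), ∀ q ∈ D n ∪ D (n + 1), dist p q ≤ δ →
      ρ p q ≤ A * (1 / 2) ^ n → ‖F p - F q‖ ≤ B * C₁ * θ n := by
    intro n hn p hp q hq hd hr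
    rcases (h0 p q).eq_or_lt with h | h
    · rw [(hf p q).1 h.symm, sub_self, norm_zero]
      have := dyadicModulus_pos β (η + 1 / 2) n
      positivity
    · have hr2 : ρ p q ≤ 1 / 2 :=
        hr.trans ((mul_le_mul_of_nonneg_left (hmono n hn) (by positivity)).trans hn₀A)
      have h4 := hinc n (p, q) (Finset.mem_product.2 ⟨hp, hq⟩) hd h hr2
      have h5 := h₁ n _ h hr hr2
      refine h4.trans ?_
      calc _ ≤ B * (√(n + 1) * (C₁ * dyadicModulus β η n)) := by
            dsimp only; gcongr
        -- The factor `√(n + 1)` raises the logarithmic exponent from `η` to `η + 1/2`.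
        _ = B * C₁ * θ n := by
          rw [hθ, dyadicModulus, dyadicModulus, Real.rpow_add (by positivity), Real.sqrt_eq_rpow]
          ring
  have step : ∀ z ∈ T, ∀ n, n₀ ≤ n → dist (F (π n z)) (F (π (n + 1) z)) ≤ B * C₁ * θ n := by
    intro z hz n hn
    have hs : (1 / 2 : ℝ) ^ (n + 1) ≤ (1 / 2) ^ n := by
      rw [pow_succ]; linarith [pow_pos (show (0 : ℝ) < 1 / 2 by norm_num) n]
    rw [dist_eq_norm]
    refine link n hn _ (Finset.mem_union_left _ (hπD n z hz)) _
      (Finset.mem_union_right _ (hπD (n + 1) z hz)) ?_ ?_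
    · have := dist_triangle_left (π n z) (π (n + 1) z) z
      have := hπd n z hz
      have := hπd (n + 1) z hz
      have := hmono n hn
      linarith [pow_pos (show (0:ℝ) < 1 / 2 by norm_num) n₀]
    · have h5 := htri (π n z) z (π (n + 1) z)
      have h6 := hπρ n z hz
      have h7 := hπρ (n + 1) z hz
      rw [hsym (π n z) z] at h5
      have h8 : (0 : ℝ) < (1 / 2) ^ n := by positivity
      calc _ ≤ κ * ((1 / 2) ^ n + (1 / 2) ^ n) := by
            refine h5.trans ?_
            gcongr
            exact h7.trans hs
        _ ≤ _ := by rw [hA]; nlinarith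
  have chain : ∀ z ∈ T, ∀ n, n₀ ≤ n → dist (F (π n z)) (F z) ≤ B * C₁ * (C₂ * θ n) := by
    intro z hz n hn
    have hfin : ∀ m, dist (F (π n z)) (F (π (n + m) z)) ≤ B * C₁ * (C₂ * θ n) := by
      intro m
      refine (dist_le_range_sum_dist (fun k => F (π (n + k) z)) m).trans ?_
      calc _ ≤ ∑ k ∈ Finset.range m, B * C₁ * θ (n + k) :=
            Finset.sum_le_sum fun k _ => step z hz (n + k) (by omega)
        _ = B * C₁ * ∑ k ∈ Finset.range m, θ (n + k) := by rw [Finset.mul_sum]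
        _ ≤ _ := mul_le_mul_of_nonneg_left (h₂ n m) (by positivity)
    have hlim : Tendsto (fun m => π (n + m) z) atTop (𝓝 z) := by
      rw [tendsto_iff_dist_tendsto_zero]
      refine squeeze_zero (fun _ => dist_nonneg) (fun m => ?_)
        (hhalf.comp (tendsto_add_atTop_nat n))
      rw [dist_comm]
      have := hπd (n + m) z hz
      rwa [add_comm n m] at this ⊢
    exact le_of_tendsto' (tendsto_const_nhds.dist ((hF.tendsto z).comp hlim)) hfin
  rcases (h0 x y).eq_or_lt with h | h
  · rw [(hf x y).1 h.symm, sub_self, norm_zero]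
    have := logModulus_nonneg β (η + 1 / 2) (h0 y y)
    positivity
  have hρn₀ : ρ x y ≤ (1 / 2) ^ n₀ := hρ x y (hxy.trans (min_le_left _ _))
  obtain ⟨n, hn1, hn2⟩ := exists_nat_pow_near_of_lt_one h
    (hρn₀.trans (pow_le_one₀ (by norm_num) (by norm_num))) (show (0 : ℝ) < 1 / 2 by norm_num)
    (by norm_num)
  have hn : n₀ ≤ n := by
    have := (pow_lt_pow_iff_right_of_lt_one₀ (show (0 : ℝ) < 1 / 2 by norm_num)
      (by norm_num)).1 (hn1.trans_le hρn₀)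
    omega
  have hmid : dist (F (π n x)) (F (π n y)) ≤ B * C₁ * θ n := by
    rw [dist_eq_norm]
    refine link n hn _ (Finset.mem_union_left _ (hπD n x hx)) _
      (Finset.mem_union_left _ (hπD n y hy)) ?_ ?_
    · have := dist_triangle4 (π n x) x y (π n y)
      have h5 := hπd n x hx
      rw [dist_comm] at h5
      have := hπd n y hy
      have := hmono n hn
      have := hxy.trans (min_le_right _ _)
      linarith
    · have h5 := htri (π n x) x (π n y)
      have h6 := htri x y (π n y)
      have h7 := hπρ n x hx
      have h8 := hπρ n y hy
      rw [hsym (π n x) x] at h5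
      have h9 : (0 : ℝ) < (1 / 2) ^ n := by positivity
      have hκ0 : 0 ≤ κ := by linarith
      have h10 : ρ x (π n y) ≤ κ * (2 * (1 / 2) ^ n) :=
        h6.trans (mul_le_mul_of_nonneg_left (by linarith) hκ0)
      have h11 : (1 / 2 : ℝ) ^ n ≤ κ * (1 / 2) ^ n := le_mul_of_one_le_left h9.le hκ
      calc _ ≤ κ * (κ * (1 / 2) ^ n + κ * (2 * (1 / 2) ^ n)) :=
            h5.trans (mul_le_mul_of_nonneg_left (add_le_add (h7.trans h11) h10) hκ0)
        _ = _ := by rw [hA]; ring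
  have hfinal := h₃ n _ hn1 hn2
  have e1 := chain x hx n hn
  have e2 := chain y hy n hn
  rw [dist_comm] at e1
  rw [← dist_eq_norm]
  calc dist (F x) (F y) ≤ _ := dist_triangle4 (F x) (F (π n x)) (F (π n y)) (F y)
    _ ≤ B * C₁ * (C₂ * θ n) + B * C₁ * θ n + B * C₁ * (C₂ * θ n) := by gcongr
    _ = B * C₁ * (2 * C₂ + 1) * θ n := by ring
    _ ≤ B * C₁ * (2 * C₂ + 1) * (C₃ * logModulus β (η + 1 / 2) (ρ x y)) := by gcongr
    _ = _ := by ring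

/-- Any two points of `T` are joined by a chain of `T` with small steps, of bounded length. -/
def IsChainable (T : Set X) : Prop :=
  ∀ δ > 0, ∃ J : ℕ, ∀ x ∈ T, ∀ y ∈ T, ∃ z : ℕ → X, z 0 = x ∧ z J = y ∧ (∀ i ≤ J, z i ∈ T) ∧
    ∀ i < J, dist (z i) (z (i + 1)) ≤ δ

/-- Distant points are joined by boundedly many local steps, each with bounded increment. By
compactness `ρ`, hence also the modulus, is bounded below on distant pairs, so a bounded increment
suffices there. -/
theorem exists_logModulus [CompactSpace X] (hρc : Continuous (Function.uncurry ρ))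
    (h0 : ∀ x y, 0 ≤ ρ x y) (hf : ∀ x y, ρ x y = 0 ↔ x = y)
    (hsym : ∀ x y, ρ x y = ρ y x) {κ : ℝ} (hκ : 1 ≤ κ)
    (htri : ∀ x y z, ρ x z ≤ κ * (ρ x y + ρ y z)) (hT : IsChainable T)
    (hD : IsNetFamily ρ T D) {β : ℝ} (hβ : 0 < β) (η : ℝ) {δ : ℝ} (hδ : 0 < δ) :
    ∃ C > 0, ∀ F : X → ℂ, Continuous F → ∀ B, 0 ≤ B →
      HasNetIncrements ρ D β η δ B F → ∀ x ∈ T, ∀ y ∈ T,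
        ‖F x - F y‖ ≤ C * B * logModulus β (η + 1 / 2) (ρ x y) := by
  have hcont : ∀ ε > 0, ∃ δ > 0, ∀ x y, dist x y ≤ δ → ρ x y ≤ ε := by
    intro ε hε
    obtain ⟨δ, hδ, h⟩ := Metric.uniformContinuous_iff.1
      (CompactSpace.uniformContinuous_of_continuous hρc) ε hε
    refine ⟨δ / 2, by positivity, fun x y hxy => ?_⟩
    have h1 := @h (x, y) (x, x) (by
      rw [Prod.dist_eq, dist_self, max_eq_right dist_nonneg, dist_comm]; dsimp only; linarith)
    simp only [Function.uncurry, Real.dist_eq, (hf x x).2 rfl, sub_zero] at h1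
    exact (le_abs_self _).trans h1.le
  obtain ⟨C, hC, δ', hδ', hloc⟩ :=
    exists_local_logModulus h0 hf hsym hκ htri hcont hD hβ η hδ
  obtain ⟨J, hJ⟩ := hT δ' hδ'
  obtain ⟨U, hU0, hU⟩ : ∃ U : ℝ, 0 < U ∧ ∀ x y, ρ x y ≤ U := by
    obtain ⟨U, hU⟩ := (isCompact_range hρc).bddAbove
    exact ⟨max U 1, by positivity, fun x y => (hU ⟨(x, y), rfl⟩).trans (le_max_left _ _)⟩
  obtain ⟨u₀, hu₀, hfar⟩ : ∃ u₀ : ℝ, 0 < u₀ ∧ ∀ x y, δ' ≤ dist x y → u₀ ≤ ρ x y := by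
    have hcl : IsCompact {p : X × X | δ' ≤ dist p.1 p.2} :=
      (isClosed_le continuous_const continuous_dist).isCompact
    rcases Set.eq_empty_or_nonempty {p : X × X | δ' ≤ dist p.1 p.2} with he | hne
    · refine ⟨1, one_pos, fun x y h => ?_⟩
      have : (x, y) ∈ {p : X × X | δ' ≤ dist p.1 p.2} := h
      simp [he] at this
    · obtain ⟨p, hp, hmin⟩ := hcl.exists_isMinOn hne hρc.continuousOn
      refine ⟨ρ p.1 p.2, lt_of_le_of_ne (h0 _ _) fun h => ?_, fun x y h => hmin (a := (x, y)) h⟩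
      have h2 : δ' ≤ dist p.1 p.2 := hp
      rw [(hf _ _).1 h.symm, dist_self] at h2
      exact absurd h2 (not_le.2 hδ')
  obtain ⟨C', hC', hup⟩ := exists_logModulus_le hβ (η + 1 / 2) hU0
  obtain ⟨c, hc, hlow⟩ := exists_le_logModulus β (η + 1 / 2) hu₀ U
  refine ⟨C + J * (C * C') / c, by positivity, fun F hF B hB hinc x hx y hy => ?_⟩
  have hnn := logModulus_nonneg β (η + 1 / 2) (h0 x y)
  rcases le_total (dist x y) δ' with h | h
  · refine (hloc F hF B hB hinc x hx y hy h).trans ?_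
    have : 0 ≤ J * (C * C') / c := by positivity
    gcongr
    linarith
  · obtain ⟨z, hz0, hzJ, hzT, hzd⟩ := hJ x hx y hy
    have h1 : dist (F (z 0)) (F (z J)) ≤ J * (C * B * C') := by
      refine (dist_le_range_sum_dist (fun i => F (z i)) J).trans ?_
      refine (Finset.sum_le_card_nsmul _ _ (C * B * C') fun i hi => ?_).trans (by simp)
      have hi' := Finset.mem_range.1 hi
      rw [dist_eq_norm]
      refine (hloc F hF B hB hinc _ (hzT i hi'.le) _ (hzT (i + 1) hi') (hzd i hi')).trans ?_
      have := hup _ (h0 (z i) (z (i + 1))) (hU _ _)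
      gcongr
    rw [hz0, hzJ, dist_eq_norm] at h1
    have h2 := hlow _ (hfar x y h) (hU x y)
    calc ‖F x - F y‖ ≤ J * (C * B * C') := h1
      _ = J * (C * C') / c * B * c := by field_simp
      _ ≤ (C + J * (C * C') / c) * B * logModulus β (η + 1 / 2) (ρ x y) := by
        gcongr
        linarith

end Chaining

/-! ### Nets of geometric cardinality, and chains in convex sets. -/

section Nets

/-- Self-similarity: a single cover of the ball of radius `R` by `m` balls of radius `R q` is
rescaled into each ball of the previous generation. -/
theorem exists_ball_cover {E : Type*} [NormedAddCommGroup E] [NormedSpace ℝ E] [ProperSpace E]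
    {R q : ℝ} (hR : 0 < R) (hq : 0 < q) :
    ∃ m : ℕ, ∀ n : ℕ, ∃ s : Finset E, s.card ≤ m ^ n ∧
      ∀ x : E, ‖x‖ ≤ R → ∃ c ∈ s, ‖x - c‖ ≤ R * q ^ n := by
  classical
  obtain ⟨t, -, htf, ht⟩ := (isCompact_closedBall (0 : E) R).finite_cover_balls (mul_pos hR hq)
  lift t to Finset E using htf
  refine ⟨t.card, fun n => ?_⟩
  induction n with
  | zero => exact ⟨{0}, by simp, fun x hx => ⟨0, by simp, by simpa using hx⟩⟩
  | succ n ih =>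
    obtain ⟨s, hs, hcov⟩ := ih
    refine ⟨Finset.image₂ (fun c e => c + q ^ n • e) s t, ?_, fun x hx => ?_⟩
    · rw [pow_succ]
      exact (Finset.card_image₂_le _ _ _).trans (Nat.mul_le_mul_right _ hs)
    · obtain ⟨c, hc, hxc⟩ := hcov x hx
      have hqn : 0 < q ^ n := pow_pos hq n
      have h1 : (q ^ n)⁻¹ • (x - c) ∈ Metric.closedBall (0 : E) R := by
        rw [mem_closedBall_zero_iff, norm_smul, norm_inv, Real.norm_of_nonneg hqn.le,
          inv_mul_le_iff₀ hqn, mul_comm]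
        exact hxc
      obtain ⟨e, he, hxe⟩ := Set.mem_iUnion₂.1 (ht h1)
      refine ⟨c + q ^ n • e, Finset.mem_image₂_of_mem hc he, ?_⟩
      have h2 : x - (c + q ^ n • e) = q ^ n • ((q ^ n)⁻¹ • (x - c) - e) := by
        rw [smul_sub, smul_inv_smul₀ hqn.ne']; abel
      rw [h2, norm_smul, Real.norm_of_nonneg hqn.le]
      rw [mem_ball_iff_norm] at hxe
      calc _ ≤ q ^ n * (R * q) := by gcongr
        _ = _ := by ring

/-- The ratio `q` is small enough that both `q` and `q ^ H` are at most `1/2`; skipping `k`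
generations absorbs the constants `R` and `c`. -/
theorem exists_scale {H c : ℝ} (hH : 0 < H) (hc : 0 < c) {R : ℝ} (hR : 0 < R) :
    ∃ q : ℝ, ∃ k : ℕ, 0 < q ∧ ∀ n : ℕ, R * q ^ (k + n) ≤ (1 / 2) ^ n ∧
      c * (R * q ^ (k + n)) ^ H ≤ (1 / 2) ^ n := by
  set q : ℝ := min (1 / 2) ((1 / 2) ^ (1 / H)) with hq
  have hq0 : 0 < q := by positivity
  have hq2 : q ≤ 1 / 2 := min_le_left _ _
  have hqH : q ^ H ≤ 1 / 2 := by
    have := Real.rpow_le_rpow hq0.le (min_le_right _ _ : q ≤ (1 / 2) ^ (1 / H)) hH.le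
    rwa [← Real.rpow_mul (by norm_num), one_div_mul_cancel hH.ne', Real.rpow_one] at this
  obtain ⟨k, hk⟩ : ∃ k : ℕ, q ^ k < min 1 ((1 / c) ^ (1 / H)) / R :=
    exists_pow_lt_of_lt_one (by positivity) (by linarith)
  rw [lt_div_iff₀ hR, mul_comm] at hk
  have hk1 : R * q ^ k ≤ 1 := hk.le.trans (min_le_left _ _)
  have hk2 : c * (R * q ^ k) ^ H ≤ 1 := by
    have := Real.rpow_le_rpow (by positivity) (hk.le.trans (min_le_right _ _)) hH.le
    rw [← Real.rpow_mul (by positivity), one_div_mul_cancel hH.ne', Real.rpow_one,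
      le_div_iff₀ hc] at this
    linarith
  refine ⟨q, k, hq0, fun n => ?_⟩
  have hqn : q ^ n ≤ (1 / 2) ^ n := pow_le_pow_left₀ hq0.le hq2 n
  constructor
  · calc R * q ^ (k + n) = R * q ^ k * q ^ n := by ring
      _ ≤ 1 * (1 / 2) ^ n := by gcongr
      _ = _ := one_mul _
  · calc c * (R * q ^ (k + n)) ^ H = c * (R * q ^ k) ^ H * (q ^ H) ^ n := by
          rw [show R * q ^ (k + n) = (R * q ^ k) * q ^ n by ring,
            Real.mul_rpow (by positivity) (by positivity), ← Real.rpow_natCast (q ^ H),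
            ← Real.rpow_natCast q n, ← Real.rpow_mul hq0.le, ← Real.rpow_mul hq0.le,
            mul_comm (n : ℝ) H]
          ring
      _ ≤ 1 * (1 / 2) ^ n := by gcongr
      _ = _ := one_mul _

variable {d : ℕ} {K : Set (Euc d)} {ρ : Euc d → Euc d → ℝ}

theorem exists_isNetFamily (hK : Bornology.IsBounded K) (hρH : IsHolderControlled ρ)
    (T : Set K) :
    ∃ D : ℕ → Finset K, IsNetFamily (fun x y : K => ρ x y) T D ∧
      ∃ A B : ℕ, ∀ n, (D n).card ≤ B * A ^ n := by
  classical
  rcases T.eq_empty_or_nonempty with rfl | ⟨t₀, ht₀⟩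
  · exact ⟨fun _ => ∅, ⟨by simp, by simp⟩, 0, 0, by simp⟩
  obtain ⟨H, _, _, c, hH, -, -, -, hc, hρc⟩ := hρH
  obtain ⟨R, hR, hKR⟩ := hK.exists_pos_norm_le
  obtain ⟨q, k, hq, hqk⟩ := exists_scale hH hc (R := 2 * R) (by positivity)
  obtain ⟨m, hm⟩ := exists_ball_cover (E := Euc d) hR hq
  choose s hs hcov using hm
  let r : ℕ → ℝ := fun n => R * q ^ (k + n)
  -- Covering centres need not lie in `T`: each is replaced by a point of `T` in its ball, which
  -- doubles the radius (hence `2 * R` above), or by the dummy `t₀` if there is none.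
  let f : ℕ → Euc d → K := fun n c =>
    if h : ∃ x ∈ T, ‖(x : Euc d) - c‖ ≤ r n then h.choose else t₀
  have hfT : ∀ n c, f n c ∈ T := by
    intro n c
    by_cases h : ∃ x ∈ T, ‖(x : Euc d) - c‖ ≤ r n
    · simp only [f, dif_pos h]; exact h.choose_spec.1
    · simp only [f, dif_neg h]; exact ht₀
  refine ⟨fun n => (s (k + n)).image (f n), ⟨fun n => ?_, fun n x hx => ?_⟩, m, m ^ k, fun n => ?_⟩
  · intro x hx
    obtain ⟨c, -, rfl⟩ := Finset.mem_image.1 (Finset.mem_coe.1 hx)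
    exact hfT n c
  · obtain ⟨c₀, hc₀, hxc⟩ := hcov (k + n) x (hKR x x.2)
    have h : ∃ x ∈ T, ‖(x : Euc d) - c₀‖ ≤ r n := ⟨x, hx, hxc⟩
    have h1 : ‖(f n c₀ : Euc d) - c₀‖ ≤ r n := by
      simp only [f, dif_pos h]; exact h.choose_spec.2
    have h2 : ‖(x : Euc d) - f n c₀‖ ≤ 2 * R * q ^ (k + n) := by
      calc _ = ‖((x : Euc d) - c₀) - ((f n c₀ : Euc d) - c₀)‖ := by rw [sub_sub_sub_cancel_right]
        _ ≤ ‖(x : Euc d) - c₀‖ + ‖(f n c₀ : Euc d) - c₀‖ := norm_sub_le _ _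
        _ ≤ r n + r n := add_le_add hxc h1
        _ = _ := by simp only [r]; ring
    obtain ⟨h3, h4⟩ := hqk n
    have h5 : (1 / 2 : ℝ) ^ n ≤ 1 := pow_le_one₀ (by norm_num) (by norm_num)
    refine ⟨f n c₀, Finset.mem_image_of_mem _ hc₀, ?_, ?_⟩
    · rw [Subtype.dist_eq, dist_eq_norm]; exact h2.trans h3
    · refine (hρc _ _ (h2.trans (h3.trans h5))).2.trans (le_trans ?_ h4)
      gcongr
  · refine Finset.card_image_le.trans ((hs _).trans (le_of_eq ?_))
    rw [pow_add]

theorem card_netPairs_le {X : Type*} [DecidableEq X] {D : ℕ → Finset X} {A B : ℕ}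
    (h : ∀ n, (D n).card ≤ B * A ^ n) (n : ℕ) :
    (netPairs D n).card ≤ (B * (1 + A)) ^ 2 * (A ^ 2) ^ n := by
  have h1 : (D n ∪ D (n + 1)).card ≤ B * (1 + A) * A ^ n := by
    refine (Finset.card_union_le _ _).trans ((add_le_add (h n) (h (n + 1))).trans (le_of_eq ?_))
    ring
  rw [netPairs, Finset.card_product]
  refine (Nat.mul_le_mul h1 h1).trans (le_of_eq ?_)
  ring

theorem isChainable_of_convex (hK : Bornology.IsBounded K) {T : Set K}
    (hT : Convex ℝ (Subtype.val '' T)) : IsChainable T := by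
  intro δ hδ
  obtain ⟨R, hR, hKR⟩ := hK.exists_pos_norm_le
  obtain ⟨J, hJ⟩ := exists_nat_gt (2 * R / δ)
  have hJ0 : (0 : ℝ) < J := lt_of_le_of_lt (by positivity) hJ
  refine ⟨J, fun x hx y hy => ?_⟩
  have hex : ∀ i : ℕ, ∃ z : K, i ≤ J →
      (z ∈ T ∧ (z : Euc d) = AffineMap.lineMap (x : Euc d) (y : Euc d) ((i : ℝ) / J)) := by
    intro i
    by_cases hi : i ≤ J
    · have hmem : AffineMap.lineMap (x : Euc d) (y : Euc d) ((i : ℝ) / J) ∈ Subtype.val '' T := by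
        refine hT.lineMap_mem ⟨x, hx, rfl⟩ ⟨y, hy, rfl⟩ ⟨by positivity, ?_⟩
        rw [div_le_one hJ0]; exact_mod_cast hi
      obtain ⟨z, hz, he⟩ := hmem
      exact ⟨z, fun _ => ⟨hz, he⟩⟩
    · exact ⟨x, fun h => absurd h hi⟩
  choose z hz using hex
  refine ⟨z, ?_, ?_, fun i hi => (hz i hi).1, fun i hi => ?_⟩
  · apply Subtype.ext; rw [(hz 0 (Nat.zero_le _)).2]; simp
  · apply Subtype.ext; rw [(hz J le_rfl).2, div_self hJ0.ne']; simp
  · rw [Subtype.dist_eq, (hz i hi.le).2, (hz (i + 1) hi).2, dist_lineMap_lineMap, Real.dist_eq]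
    have h1 : (i : ℝ) / J - ((i + 1 : ℕ) : ℝ) / J = -(1 / J) := by push_cast; ring
    rw [h1, abs_neg, abs_of_pos (by positivity), one_div, inv_mul_le_iff₀ hJ0]
    have h2 : dist (x : Euc d) (y : Euc d) ≤ 2 * R := by
      rw [dist_eq_norm]
      have := norm_sub_le (x : Euc d) (y : Euc d)
      linarith [hKR x x.2, hKR y y.2]
    rw [div_lt_iff₀ hδ] at hJ
    linarith

theorem isCompact_box (lo hi : Fin d → ℝ) : IsCompact (box lo hi) := by
  have h : box lo hi = (EuclideanSpace.equiv (Fin d) ℝ).toHomeomorph ⁻¹' Set.Icc lo hi := by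
    ext x
    simp [box, Pi.le_def, forall_and]
  rw [h, Homeomorph.isCompact_preimage]
  exact isCompact_Icc

theorem convex_box (lo hi : Fin d → ℝ) : Convex ℝ (box lo hi) := by
  have h : box lo hi = (EuclideanSpace.equiv (Fin d) ℝ).toLinearMap ⁻¹' Set.Icc lo hi := by
    ext x
    simp [box, Pi.le_def, forall_and]
  rw [h]
  exact (convex_Icc lo hi).linear_preimage _

end Nets

/-! ### Assembling the probabilistic and pathwise parts. -/

section Assembly

set_option linter.unusedSectionVars false

variable {Ω : Type*} [MeasurableSpace Ω] {μ : Measure Ω} {d : ℕ} {K : Set (Euc d)}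
  {W : ℕ → K → Ω → ℂ} {g : ℕ → Ω → ℂ} {ρ : Euc d → Euc d → ℝ} {β η : Ω → ℝ} {b : ℕ → Ω → ℝ}

theorem hasNetIncrements_of_hasTailControl [DecidableEq K] {ω : Ω} {D : ℕ → Finset K}
    {T : Set K} (hDT : ∀ n, ↑(D n) ⊆ T) {k : ℕ}
    (hk : HasTailControl (netPairs D) (fun n x => W n x ω) (fun i => g i ω) k) {N : ℕ} {δ : ℝ}
    (hb : 0 ≤ b N ω) (hrate : ∀ x ∈ T, ∀ y ∈ T, dist x y ≤ δ → restParam W N x y ω ≤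
      ENNReal.ofReal (b N ω) *
        (ENNReal.ofReal (ρ x y) ^ β ω * ENNReal.ofReal |Real.log (ρ x y)| ^ η ω)) (M : ℕ) :
    HasNetIncrements (fun x y : K => ρ x y) D (β ω) (η ω) δ
      (k * √(Real.log (N + 2)) * b N ω) (fun x => ∑ i ∈ Finset.Ico N M, W i x ω * g i ω) := by
  rintro n ⟨x, y⟩ hp hd hρ0 hρ2
  dsimp only at hd hρ0 hρ2 ⊢
  have hT : ∀ z ∈ D n ∪ D (n + 1), z ∈ T := fun z hz =>
    (Finset.mem_union.1 hz).elim (fun h => hDT _ h) (fun h => hDT _ h)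
  have hxy := Finset.mem_product.1 hp
  have h1 := hk n (x, y) hp N M
  have h2 := hrate x (hT x hxy.1) y (hT y hxy.2) hd
  -- As `0 < ρ ≤ 1/2`, both bases are positive and the bound in `[0, ∞]` becomes a real one, even
  -- for `η < 0`.
  have hlog : 0 < |Real.log (ρ x y)| :=
    abs_pos.2 (Real.log_neg hρ0 (by linarith)).ne
  rw [ENNReal.ofReal_rpow_of_pos hρ0, ENNReal.ofReal_rpow_of_pos hlog,
    ← ENNReal.ofReal_mul (by positivity), ← ENNReal.ofReal_mul hb] at h2
  have h3 := h1.trans (mul_le_mul_right h2 _)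
  rw [← ENNReal.ofReal_mul (by positivity), ← ofReal_norm,
    ENNReal.ofReal_le_ofReal_iff (by positivity)] at h3
  rw [← Finset.sum_sub_distrib]
  simp_rw [← sub_mul]
  refine h3.trans (le_of_eq ?_)
  ring

theorem partialSum_sub_eq (W : ℕ → K → Ω → ℂ) (g : ℕ → Ω → ℂ) {N M : ℕ} (h : N ≤ M) (x : K)
    (ω : Ω) : partialSum W g M x ω - partialSum W g N x ω =
      ∑ i ∈ Finset.Ico N M, W i x ω * g i ω := by
  rw [partialSum, partialSum, Finset.sum_Ico_eq_sub _ h]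

/-- Approximation uniform in `M` by convergent sequences transfers the Cauchy property. -/
theorem tendsto_partialSum_of_forall_near {ω : Ω} {x : K}
    (h : ∀ ε > 0, ∃ y : K, (∃ c, Tendsto (fun N => partialSum W g N y ω) atTop (𝓝 c)) ∧
      ∀ M, ‖partialSum W g M x ω - partialSum W g M y ω‖ ≤ ε) :
    Tendsto (fun N => partialSum W g N x ω) atTop (𝓝 (limitField W g x ω)) := by
  refine tendsto_nhds_limUnder (cauchySeq_tendsto_of_complete ?_)
  rw [Metric.cauchySeq_iff']
  intro ε hε
  obtain ⟨y, ⟨c, hc⟩, hy⟩ := h (ε / 4) (by positivity)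
  obtain ⟨N, hN⟩ := Metric.cauchySeq_iff'.1 hc.cauchySeq (ε / 4) (by positivity)
  refine ⟨N, fun M hM => ?_⟩
  have h1 := hy M
  have h2 := hy N
  have h3 := hN M hM
  rw [← dist_eq_norm] at h1 h2
  rw [dist_comm] at h2
  have := dist_triangle4 (partialSum W g M x ω) (partialSum W g M y ω) (partialSum W g N y ω)
    (partialSum W g N x ω)
  linarith

/-- Common core of both versions: a rate for close pairs of a convex `T` suffices, and `δ` may
depend on `ω`. Only countably many almost sure statements are used, all about the nets or about
continuity of the `W n`. -/
theorem hasRestModulusOn_of_local_rate [IsProbabilityMeasure μ] (hK : IsCompact K)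
    (hWg : IsCondSubGaussian μ W g) (hρ : IsQuasiMetric ρ) (hρH : IsHolderControlled ρ)
    {T : Set K} (hT : Convex ℝ (Subtype.val '' T)) (hβ : ∀ ω, 0 < β ω) (hb : ∀ N ω, 0 < b N ω)
    (hrate : ∀ᵐ ω ∂μ, ∃ δ > 0, ∀ N, ∀ x ∈ T, ∀ y ∈ T, dist x y ≤ δ → restParam W N x y ω ≤
      ENNReal.ofReal (b N ω) *
        (ENNReal.ofReal (ρ x y) ^ β ω * ENNReal.ofReal |Real.log (ρ x y)| ^ η ω)) :
    HasRestModulusOn μ W g ρ β η b T := by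
  classical
  have : CompactSpace K := isCompact_iff_compactSpace.1 hK
  obtain ⟨D, hD, A, B, hcard⟩ := exists_isNetFamily hK.isBounded hρH T
  obtain ⟨κ, hκ, htri⟩ := hρ.quasi_triangle
  have hconv : ∀ᵐ ω ∂μ, ∀ n, ∀ y ∈ D n,
      ∃ c, Tendsto (fun N => partialSum W g N y ω) atTop (𝓝 c) :=
    ae_all_iff.2 fun n => (Finset.eventually_all (D n)).2 fun y _ => hWg.ae_exists_tendsto y
  filter_upwards [hWg.ae_exists_hasTailControl (card_netPairs_le hcard), hWg.continuous_W, hconv,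
    hrate] with ω ⟨k, hk⟩ hWc hDc ⟨δ, hδ, hr⟩
  obtain ⟨C, hC, hmod⟩ := exists_logModulus (ρ := fun x y : K => ρ x y)
    (hρ.continuous.comp ((continuous_subtype_val.comp continuous_fst).prodMk
      (continuous_subtype_val.comp continuous_snd)))
    (fun x y => hρ.nonneg x y) (fun x y => (hρ.faithful x y).trans Subtype.coe_inj)
    (fun x y => hρ.symm x y) hκ (fun x y z => htri x y z)
    (isChainable_of_convex hK.isBounded hT) hD (hβ ω) (η ω) hδ
  have hbound : ∀ N M, N ≤ M → ∀ x ∈ T, ∀ y ∈ T,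
      ‖(partialSum W g M x ω - partialSum W g N x ω) -
        (partialSum W g M y ω - partialSum W g N y ω)‖ ≤
        C * (k * √(Real.log (N + 2)) * b N ω) * logModulus (β ω) (η ω + 1 / 2) (ρ x y) := by
    intro N M hNM x hx y hy
    rw [partialSum_sub_eq W g hNM, partialSum_sub_eq W g hNM]
    refine hmod (fun x => ∑ i ∈ Finset.Ico N M, W i x ω * g i ω) ?_ _ ?_
      (hasNetIncrements_of_hasTailControl hD.subset hk (hb N ω).le (hr N) M) x hx y hy
    · exact continuous_finsetSum _ fun i _ => (hWc i).mul continuous_const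
    · have := (hb N ω).le
      positivity
  have hlim : ∀ x ∈ T,
      Tendsto (fun N => partialSum W g N x ω) atTop (𝓝 (limitField W g x ω)) := by
    intro x hx
    refine tendsto_partialSum_of_forall_near fun ε hε => ?_
    -- The case `N = 0` of `hbound`: a modulus of continuity common to all `S_M`.
    set L := C * (k * √(Real.log ((0 : ℕ) + 2)) * b 0 ω) with hL
    have hL0 : 0 ≤ L := by
      have := (hb 0 ω).le
      positivity
    obtain ⟨δ₁, hδ₁, h1⟩ := tendsto_logModulus (hβ ω) (η ω + 1 / 2) (ε / (L + 1)) (by positivity)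
    obtain ⟨n, hn⟩ := exists_pow_lt_of_lt_one hδ₁ (show (1 / 2 : ℝ) < 1 by norm_num)
    obtain ⟨y, hy, -, hρy⟩ := hD.exists_near n x hx
    refine ⟨y, hDc n y hy, fun M => ?_⟩
    have h2 := hbound 0 M (Nat.zero_le M) x hx y (hD.subset n hy)
    have h3 := (h1 _ (hρ.nonneg x y) (hρy.trans hn.le)).le
    have h4 : ∀ z, partialSum W g 0 z ω = 0 := fun z => by simp [partialSum]
    rw [h4, h4, sub_zero, sub_zero] at h2
    refine h2.trans ?_
    have h5 := logModulus_nonneg (β ω) (η ω + 1 / 2) (hρ.nonneg x y)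
    calc L * logModulus (β ω) (η ω + 1 / 2) (ρ x y)
        ≤ (L + 1) * (ε / (L + 1)) := by gcongr; linarith
      _ = ε := by field_simp
  -- `k` may be zero; `k + 1` keeps the constant positive.
  refine ⟨hlim, C * (k + 1), by positivity, fun N x hx y hy => ?_⟩
  have h1 := (((hlim x hx).sub_const (partialSum W g N x ω)).sub
    ((hlim y hy).sub_const (partialSum W g N y ω))).norm
  have h2 := le_of_tendsto h1 ((eventually_ge_atTop N).mono fun M hM => hbound N M hM x hx y hy)
  refine h2.trans ?_
  have h3 := logModulus_nonneg (β ω) (η ω + 1 / 2) (hρ.nonneg x y)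
  have h4 := (hb N ω).le
  calc C * (k * √(Real.log (N + 2)) * b N ω) * logModulus (β ω) (η ω + 1 / 2) (ρ x y)
      = C * k * (√(Real.log (N + 2)) * b N ω * logModulus (β ω) (η ω + 1 / 2) (ρ x y)) := by ring
    _ ≤ C * (k + 1) *
        (√(Real.log (N + 2)) * b N ω * logModulus (β ω) (η ω + 1 / 2) (ρ x y)) := by
        gcongr; linarith
    _ = _ := by rw [logModulus]; ring

theorem ae_exists_norm_rest_le (hK : IsCompact K) (hρ : IsQuasiMetric ρ) {T : Set K}
    (hβ : ∀ ω, 0 < β ω) (hb : ∀ N ω, 0 < b N ω) (hmod : HasRestModulusOn μ W g ρ β η b T)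
    {x₀ : K} (hx₀ : x₀ ∈ T) (hpt : HasPointwiseRate μ W g b x₀) :
    ∀ᵐ ω ∂μ, ∃ C : ℝ, 0 < C ∧ ∀ N : ℕ, ∀ x ∈ T,
      ‖rest W g N x ω‖ ≤ C * (b N ω * √(Real.log (N + 2))) := by
  obtain ⟨U, hU0, hU⟩ : ∃ U : ℝ, 0 < U ∧ ∀ x y : K, ρ x y ≤ U := by
    obtain ⟨U, hU⟩ := ((hK.prod hK).image hρ.continuous).bddAbove
    exact ⟨max U 1, by positivity,
      fun x y => (hU ⟨((x : Euc d), (y : Euc d)), ⟨x.2, y.2⟩, rfl⟩).trans (le_max_left _ _)⟩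
  filter_upwards [hmod, hpt] with ω ⟨_, C, hC, h⟩ hp
  obtain ⟨C', hC', h'⟩ := exists_logModulus_le (hβ ω) (η ω + 1 / 2) hU0
  refine ⟨1 + C * C', by positivity, fun N x hx => ?_⟩
  have h1 := h N x hx x₀ hx₀
  have h2 := h' _ (hρ.nonneg x x₀) (hU x x₀)
  rw [logModulus] at h2
  have h3 := (hb N ω).le
  have h4 := norm_le_norm_add_norm_sub' (rest W g N x ω) (rest W g N x₀ ω)
  calc ‖rest W g N x ω‖ ≤ ‖rest W g N x₀ ω‖ + ‖rest W g N x ω - rest W g N x₀ ω‖ := h4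
    _ ≤ b N ω * √(Real.log (N + 2)) + C * b N ω * √(Real.log (N + 2)) * C' := by
        refine add_le_add (hp N) (h1.trans ?_)
        gcongr
    _ = _ := by ring

theorem HasRateAt.ae_mem [IsProbabilityMeasure μ] {x₀ : K} {Ω' : Set Ω} {γ : Ω → ℝ}
    (h : HasRateAt μ W ρ x₀ Ω' γ β η b) : ∀ᵐ ω ∂μ, ω ∈ Ω' :=
  (prob_compl_eq_zero_iff h.measurableSet_event).2 h.measure_event

/-- The rate assumption at every point of a compact set holds for all pairs of points at a distance
less than a Lebesgue number of the corresponding cover. -/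
theorem exists_rate_of_forall_hasRateAt (hK : IsCompact K) {Ω' : Set Ω}
    (h : ∀ x₀ : K, ∃ γ : Ω → ℝ, HasRateAt μ W ρ x₀ Ω' γ β η b) {ω : Ω} (hω : ω ∈ Ω') :
    ∃ δ > 0, ∀ N, ∀ x y : K, dist x y ≤ δ → restParam W N x y ω ≤ ENNReal.ofReal (b N ω) *
      (ENNReal.ofReal (ρ x y) ^ β ω * ENNReal.ofReal |Real.log (ρ x y)| ^ η ω) := by
  have : CompactSpace K := isCompact_iff_compactSpace.1 hK
  choose γ hγ using h
  obtain ⟨δ, hδ, hcov⟩ := lebesgue_number_lemma_of_metric (isCompact_univ (X := K))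
    (c := fun x : K => Metric.ball x (γ x ω)) (fun _ => Metric.isOpen_ball)
    (fun x _ => Set.mem_iUnion.2 ⟨x, Metric.mem_ball_self ((hγ x).γ_pos ω)⟩)
  -- Halving makes the non-strict bound on the distance fit in an open Lebesgue ball.
  refine ⟨δ / 2, by positivity, fun N x y hxy => ?_⟩
  obtain ⟨z, hz⟩ := hcov x (Set.mem_univ x)
  refine (hγ z).bound ω hω N x y (Metric.ball_subset_closedBall (hz (Metric.mem_ball_self hδ)))
    (Metric.ball_subset_closedBall (hz ?_))
  rw [Metric.mem_ball, dist_comm]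
  linarith

end Assembly

end SubGaussianSeries

end

theorem corollary3p4 {Ω : Type*} [MeasurableSpace Ω] (μ : Measure Ω) [IsProbabilityMeasure μ]
    (d : ℕ) (hd : 1 ≤ d) (lo hi : Fin d → ℝ) (hlohi : ∀ j, lo j ≤ hi j)
    (W : ℕ → SubGaussianSeries.box lo hi → Ω → ℂ) (g : ℕ → Ω → ℂ)
    (hWg : SubGaussianSeries.IsCondSubGaussian μ W g)
    (ρ : SubGaussianSeries.Euc d → SubGaussianSeries.Euc d → ℝ)
    (hρ : SubGaussianSeries.IsQuasiMetric ρ) (hρH : SubGaussianSeries.IsHolderControlled ρ)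
    (Ω' : Set Ω) (β η : Ω → ℝ) (b : ℕ → Ω → ℝ) :
    -- global version: the rate assumption at every point, only `γ` depending on the point
    ((∀ x₀ : SubGaussianSeries.box lo hi, ∃ γ : Ω → ℝ,
        SubGaussianSeries.HasRateAt μ W ρ x₀ Ω' γ β η b) →
      SubGaussianSeries.HasRestModulusOn μ W g ρ β η b Set.univ ∧
      ((∃ x₀ : SubGaussianSeries.box lo hi, SubGaussianSeries.HasPointwiseRate μ W g b x₀) →
        ∀ᵐ ω ∂μ, (⨆ (N : ℕ) (x : SubGaussianSeries.box lo hi),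
          ENNReal.ofReal (‖SubGaussianSeries.rest W g N x ω‖ /
            (b N ω * √(Real.log (N + 2))))) < ⊤)) ∧
    -- version on a ball: the rate assumption at one point, with a deterministic radius
    (∀ (x₀ : SubGaussianSeries.box lo hi) (γ : ℝ),
      SubGaussianSeries.HasRateAt μ W ρ x₀ Ω' (fun _ => γ) β η b →
      SubGaussianSeries.HasRestModulusOn μ W g ρ β η b (Metric.closedBall x₀ γ) ∧
      (SubGaussianSeries.HasPointwiseRate μ W g b x₀ →
        ∀ᵐ ω ∂μ, ∃ C : ℝ, 0 < C ∧ ∀ N : ℕ, ∀ x ∈ Metric.closedBall x₀ γ,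
          ‖SubGaussianSeries.rest W g N x ω‖ ≤ C * (b N ω * √(Real.log (N + 2))))) := by
  have hK := SubGaussianSeries.isCompact_box lo hi
  have hconv := SubGaussianSeries.convex_box lo hi
  refine ⟨fun h => ?_, fun x₀ γ h => ?_⟩
  -- The corner `lo` serves as a point of the box at which to read off the facts on `Ω'`, `β` and
  -- `b` common to all points.
  · obtain ⟨_, h₀⟩ := h ⟨WithLp.toLp 2 lo, fun j => ⟨le_rfl, hlohi j⟩⟩
    have hβ : ∀ ω, 0 < β ω := fun ω => (h₀.β_mem ω).1
    have hmod : SubGaussianSeries.HasRestModulusOn μ W g ρ β η b Set.univ := by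
      refine SubGaussianSeries.hasRestModulusOn_of_local_rate hK hWg hρ hρH
        (by rwa [Subtype.coe_image_univ]) hβ h₀.b_pos ?_
      filter_upwards [h₀.ae_mem] with ω hω
      obtain ⟨δ, hδ, hr⟩ := SubGaussianSeries.exists_rate_of_forall_hasRateAt hK h hω
      exact ⟨δ, hδ, fun N x _ y _ => hr N x y⟩
    refine ⟨hmod, fun ⟨x₀, hx₀⟩ => ?_⟩
    filter_upwards [SubGaussianSeries.ae_exists_norm_rest_le hK hρ hβ h₀.b_pos hmod
      (Set.mem_univ x₀) hx₀] with ω ⟨C, hC, hle⟩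
    refine lt_of_le_of_lt (iSup₂_le fun N x => ENNReal.ofReal_le_ofReal ?_)
      (ENNReal.ofReal_lt_top (r := C))
    have hlog : 0 < Real.log (N + 2) := Real.log_pos (by linarith [Nat.cast_nonneg (α := ℝ) N])
    have hb := h₀.b_pos N ω
    rw [div_le_iff₀ (by positivity)]
    exact hle N x (Set.mem_univ x)
  · have hβ : ∀ ω, 0 < β ω := fun ω => (h.β_mem ω).1
    have hball : Convex ℝ (Subtype.val '' Metric.closedBall x₀ γ) := by
      have : Subtype.val '' Metric.closedBall x₀ γ =
          Metric.closedBall (x₀ : SubGaussianSeries.Euc d) γ ∩ SubGaussianSeries.box lo hi := by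
        rw [Set.inter_comm, ← Subtype.image_preimage_coe]
        rfl
      rw [this]
      exact (convex_closedBall _ _).inter hconv
    have hmod : SubGaussianSeries.HasRestModulusOn μ W g ρ β η b (Metric.closedBall x₀ γ) := by
      refine SubGaussianSeries.hasRestModulusOn_of_local_rate hK hWg hρ hρH hball hβ h.b_pos ?_
      filter_upwards [h.ae_mem] with ω hω
      -- The rate holds for all pairs of the ball, so any `δ` would do.
      exact ⟨1, one_pos, fun N x hx y hy _ => h.bound ω hω N x y hx hy⟩
    -- Positivity of the deterministic radius is stated for each `ω`, so some `ω` is needed to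
    -- extract it.
    obtain ⟨ω₀⟩ := nonempty_of_isProbabilityMeasure μ
    exact ⟨hmod, SubGaussianSeries.ae_exists_norm_rest_le hK hρ hβ h.b_pos hmod
      (Metric.mem_closedBall_self (h.γ_pos ω₀).le)⟩
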